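/- Let $i\ge 0$ be an integer and let $C$ be a smooth connected projective complex algebraic curve of genus $g=h^1(C,\mathcal O_C)=2i+1$ whose gonality is at most $i+1$; here the gonality of $C$ is the least degree of a line bundle $A$ on $C$ with $h^0(C,A)\ge 2$. Then for every line bundle $L$ of degree $2g$ on $C$, $$\dim_{\mathbb C} K_{i,1}(C,L)\ \ge\ i ,$$ where the Koszul cohomology group $K_{p,1}(C,L)$ is the cohomology at the middle term of the Koszul complex $$\bigwedge^{p+1}H^0(C,L)\otimes H^0(C,\mathcal O_C)\longrightarrow \bigwedge^{p}H^0(C,L)\otimes H^0(C,L)\longrightarrow \bigwedge^{p-1}H^0(C,L)\otimes H^0(C,L^{\otimes 2}),$$ with differentials $v_1\wedge\dots\wedge v_{q}\otimes m\mapsto\sum_{j}(-1)^{j-1}v_1\wedge\dots\wedge\widehat{v_j}\wedge\dots\wedge v_{q}\otimes v_j m$. -/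

import Mathlib

open CategoryTheory AlgebraicGeometry TopologicalSpace
open scoped TensorProduct

noncomputable section

section Koszul

variable {k V M N : Type*} [CommRing k] [AddCommGroup V] [Module k V]
  [AddCommGroup M] [Module k M] [AddCommGroup N] [Module k N]

/-- For a bilinear multiplication `μ : V × M → N`, the map sending `v` to the alternating map
`w ↦ (m ↦ μ v m ⊗ (w₁ ∧ … ∧ w_p))`. -/
def koszulAux (μ : V →ₗ[k] M →ₗ[k] N) (p : ℕ) :
    V →ₗ[k] V [⋀^Fin p]→ₗ[k] (M →ₗ[k] N ⊗[k] (⋀[k]^p V)) where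
  toFun v := ((LinearMap.lcomp k (N ⊗[k] (⋀[k]^p V)) (μ v)).comp
    (TensorProduct.mk k N (⋀[k]^p V)).flip).compAlternatingMap (exteriorPower.ιMulti k p)
  map_add' v w := by
    ext a m
    simp
  map_smul' c v := by
    ext a m
    simp [TensorProduct.smul_tmul']

/-- The Koszul differential `M ⊗ ⋀^{p+1} V → N ⊗ ⋀^p V` of a multiplication `μ : V × M → N`,
`m ⊗ v₀ ∧ … ∧ v_p ↦ ∑ⱼ (-1)ʲ vⱼ m ⊗ v₀ ∧ … v̂ⱼ … ∧ v_p`. -/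
def koszulDifferential (μ : V →ₗ[k] M →ₗ[k] N) (p : ℕ) :
    M ⊗[k] (⋀[k]^(p + 1) V) →ₗ[k] N ⊗[k] (⋀[k]^p V) :=
  TensorProduct.lift (exteriorPower.alternatingMapLinearEquiv
    (AlternatingMap.alternatizeUncurryFin (koszulAux μ p))).flip

theorem koszulDifferential_tmul_ιMulti (μ : V →ₗ[k] M →ₗ[k] N) (p : ℕ)
    (v : Fin (p + 1) → V) (m : M) :
    koszulDifferential μ p (m ⊗ₜ[k] exteriorPower.ιMulti k (p + 1) v) =
      ∑ j : Fin (p + 1), (-1 : ℤ) ^ (j : ℕ) •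
        (μ (v j) m ⊗ₜ[k] exteriorPower.ιMulti k p (j.removeNth v)) := by
  simp [koszulDifferential, koszulAux, AlternatingMap.alternatizeUncurryFin_apply,
    LinearMap.sum_apply]

/-- The Koszul cycles in `M ⊗ ⋀^p V`: the kernel of `M ⊗ ⋀^p V → N ⊗ ⋀^{p-1} V`
(the target is zero for `p = 0`). -/
def koszulCycles (μ : V →ₗ[k] M →ₗ[k] N) : (p : ℕ) → Submodule k (M ⊗[k] (⋀[k]^p V))
  | 0 => ⊤
  | p + 1 => LinearMap.ker (koszulDifferential μ p)

/-- The cohomology at the middle term of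
`M₀ ⊗ ⋀^{p+1} V → M₁ ⊗ ⋀^p V → M₂ ⊗ ⋀^{p-1} V`. -/
abbrev KoszulCohomology {M₀ M₁ M₂ : Type*} [AddCommGroup M₀] [Module k M₀]
    [AddCommGroup M₁] [Module k M₁] [AddCommGroup M₂] [Module k M₂]
    (μ₀ : V →ₗ[k] M₀ →ₗ[k] M₁) (μ₁ : V →ₗ[k] M₁ →ₗ[k] M₂) (p : ℕ) : Type _ :=
  koszulCycles μ₁ p ⧸
    (LinearMap.range (koszulDifferential μ₀ p)).submoduleOf (koszulCycles μ₁ p)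

end Koszul

/-- A smooth (connected, complete) complex algebraic curve. -/
structure SmoothCurve where
  /-- the underlying scheme -/
  X : Scheme.{0}
  /-- the structure morphism -/
  π : X ⟶ Spec (.of ℂ)
  [smooth : SmoothOfRelativeDimension 1 π]
  [proper : IsProper π]
  [integral : IsIntegral X]

namespace SmoothCurve

attribute [instance] SmoothCurve.smooth SmoothCurve.proper SmoothCurve.integral

variable (C : SmoothCurve)

instance : IsLocallyNoetherian C.X := LocallyOfFiniteType.isLocallyNoetherian C.π

/-- The ring of global functions `H⁰(C, 𝒪_C)`. -/
def Functions : Type := Γ(C.X, ⊤)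

instance : CommRing C.Functions := inferInstanceAs (CommRing Γ(C.X, ⊤))

/-- The inclusion of constants `ℂ → H⁰(C, 𝒪_C)`. -/
def scalars : ℂ →+* C.Functions :=
  ((Scheme.ΓSpecIso (.of ℂ)).inv ≫ C.π.appTop).hom

instance : Algebra ℂ C.Functions := C.scalars.toAlgebra

instance : Nonempty (⊤ : C.X.Opens) := ⟨⟨genericPoint C.X, trivial⟩⟩

/-- The function field `ℂ(C)`. -/
def K : Type := C.X.functionField

instance : Field C.K := inferInstanceAs (Field C.X.functionField)

instance : Algebra ℂ C.K :=
  RingHom.toAlgebra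
    (RingHom.comp (show C.Functions →+* C.K from (C.X.germToFunctionField ⊤).hom) C.scalars)

/-- The closed points of `C`. -/
abbrev Point : Type := {x : C.X // IsClosed ({x} : Set C.X)}

/-- Divisors on `C`: finite formal sums of closed points. -/
abbrev Divisor : Type := C.Point →₀ ℤ

/-- The degree of a divisor. -/
def divisorDegree (D : C.Divisor) : ℤ := D.sum fun _ n => n

/-! ### The genus -/

/-- The local ring `𝒪_{C,x}` as a subspace of the function field. -/
def localRing (x : C.Point) : Submodule ℂ C.K where
  carrier := Set.range
    (algebraMap (C.X.presheaf.stalk x.1) C.X.functionField)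
  add_mem' := by
    rintro _ _ ⟨a, rfl⟩ ⟨b, rfl⟩
    exact ⟨a + b, map_add _ a b⟩
  zero_mem' := ⟨0, map_zero _⟩
  smul_mem' := by
    rintro c _ ⟨a, rfl⟩
    have hx : x.1 ∈ (⊤ : C.X.Opens) := TopologicalSpace.Opens.mem_top _
    refine ⟨C.X.presheaf.germ ⊤ x.1 hx (show Γ(C.X, ⊤) from C.scalars c) * a, ?_⟩
    rw [map_mul, C.X.algebraMap_germ_eq_germToFunctionField hx]
    rfl

/-- Families `(f_x)` of rational functions with `f_x ∈ 𝒪_{C,x}` for all but finitely many `x`. -/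
def adeles : Submodule ℂ (C.Point → C.K) where
  carrier := {f | {x | f x ∉ C.localRing x}.Finite}
  add_mem' := by
    intro f g hf hg
    refine (hf.union hg).subset fun x hx => ?_
    by_contra h
    simp only [Set.mem_union, Set.mem_ofPred_eq, not_or, not_not] at h
    exact hx ((C.localRing x).add_mem h.1 h.2)
  zero_mem' := by simp
  smul_mem' := by
    intro c f hf
    refine hf.subset fun x hx h => hx ((C.localRing x).smul_mem c h)

/-- Families `(f_x)` with `f_x ∈ 𝒪_{C,x}` for all `x`. -/
def integralAdeles : Submodule ℂ (C.Point → C.K) := Submodule.pi Set.univ C.localRing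

/-- The constant families. -/
def principalAdeles : Submodule ℂ (C.Point → C.K) :=
  LinearMap.range (LinearMap.pi fun _ : C.Point => (LinearMap.id : C.K →ₗ[ℂ] C.K))

/-- `H¹(C, 𝒪_C)`, computed by the flasque resolution
`0 → 𝒪_C → ℂ(C) → ⨁ₓ ℂ(C) / 𝒪_{C,x} → 0` (a constant sheaf and a direct sum of skyscrapers over
the closed points): it is the cokernel of `ℂ(C) → ⨁ₓ ℂ(C) / 𝒪_{C,x}`, where the direct sum is
written as the quotient of `adeles` by `integralAdeles`. -/
abbrev H1 : Type :=
  C.adeles ⧸ (C.integralAdeles ⊔ C.principalAdeles).submoduleOf C.adeles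

/-- The genus `h¹(C, 𝒪_C)`. -/
def genus : ℕ := Module.finrank ℂ C.H1

/-! ### Line bundles -/

/-- An `𝒪_C`-module is a line bundle if it is locally isomorphic to the structure sheaf. -/
def IsLineBundle (L : C.X.Modules) : Prop :=
  ∀ x : C.X, ∃ U : C.X.Opens, x ∈ U ∧
    Nonempty (L.restrict U.ι ≅ (SheafOfModules.unit U.toScheme.ringCatSheaf : U.toScheme.Modules))

/-- `L ≅ 𝒪_C(D)`, i.e. there is an isomorphism, compatible with restrictions, from the sections of
`L` over each nonempty open `U` to the rational functions `f` with `f = 0` or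
`ord_x f + D(x) ≥ 0` for all closed points `x ∈ U`. -/
def IsDivisorSheaf (L : C.X.Modules) (D : C.Divisor) : Prop :=
  ∃ φ : ∀ (U : C.X.Opens) [Nonempty U], Γ(L, U) →ₗ[Γ(C.X, U)] C.X.functionField,
    (∀ (U V : C.X.Opens) [Nonempty U] [Nonempty V] (i : U ⟶ V) (s : Γ(L, V)),
      φ U (L.presheaf.map i.op s) = φ V s) ∧
    ∀ (U : C.X.Opens) [Nonempty U], Function.Injective (φ U) ∧
      Set.range (φ U) =
        {f | f ≠ 0 → ∀ x : C.Point, x.1 ∈ U → 0 ≤ Scheme.ord f x.1 + D x}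

/-- The line bundle `L` has degree `d`: `L ≅ 𝒪_C(D)` for a divisor `D` of degree `d`. -/
def HasDegree (L : C.X.Modules) (d : ℤ) : Prop :=
  ∃ D : C.Divisor, C.IsDivisorSheaf L D ∧ C.divisorDegree D = d

variable {C}

/-- The space of global sections `H⁰(C, L)`. -/
def H0 (L : C.X.Modules) : Type := Γ(L, (⊤ : C.X.Opens))

instance (L : C.X.Modules) : AddCommGroup (H0 L) :=
  inferInstanceAs (AddCommGroup Γ(L, (⊤ : C.X.Opens)))

instance (L : C.X.Modules) : Module C.Functions (H0 L) :=
  inferInstanceAs (Module Γ(C.X, ⊤) Γ(L, (⊤ : C.X.Opens)))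

instance (L : C.X.Modules) : Module ℂ (H0 L) := Module.compHom (H0 L) C.scalars

instance (L : C.X.Modules) : IsScalarTower ℂ C.Functions (H0 L) where
  smul_assoc c a s := mul_smul (C.scalars c) a s

variable (C) in
/-- The gonality of `C`: the least degree of a line bundle with at least two independent
sections (a pencil). -/
def gonality : ℕ∞ :=
  sInf {n : ℕ∞ | ∃ (d : ℕ) (A : C.X.Modules), C.IsLineBundle A ∧ C.HasDegree A d ∧
    2 ≤ Module.finrank ℂ (H0 A) ∧ n = d}

/-! ### Tensor products and Koszul cohomology -/

/-- The presheaf `U ↦ L(U) ⊗ M(U)`. -/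
def presheafTensor (L M : C.X.Modules) : C.X.PresheafOfModules :=
  PresheafOfModules.Monoidal.tensorObj (R := C.X.presheaf) L.val M.val

/-- The tensor product `L ⊗ M` of `𝒪_C`-modules: the sheaf associated to `presheafTensor L M`. -/
def tensor (L M : C.X.Modules) : C.X.Modules :=
  (PresheafOfModules.sheafification (𝟙 C.X.ringCatSheaf.obj)).obj (presheafTensor L M)

/-- The canonical map `L(C) ⊗ M(C) → H⁰(C, L ⊗ M)`. -/
def tensorSections (L M : C.X.Modules) :
    H0 L ⊗[C.Functions] H0 M →ₗ[C.Functions] H0 (tensor L M) :=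
  (((PresheafOfModules.sheafificationAdjunction (𝟙 C.X.ringCatSheaf.obj)).unit.app
    (presheafTensor L M)).app (.op ⊤)).hom

/-- The multiplication of sections `H⁰(C, L) × H⁰(C, M) → H⁰(C, L ⊗ M)`. -/
def mulSections (L M : C.X.Modules) : H0 L →ₗ[ℂ] H0 M →ₗ[ℂ] H0 (tensor L M) :=
  LinearMap.mk₂ ℂ (fun s t => tensorSections L M (s ⊗ₜ t))
    (by intro s s' t; rw [TensorProduct.add_tmul, map_add])
    (by
      intro c s t
      rw [← algebraMap_smul C.Functions c s, ← TensorProduct.smul_tmul', map_smul,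
        algebraMap_smul])
    (by intro s t t'; rw [TensorProduct.tmul_add, map_add])
    (by
      intro c s t
      rw [← algebraMap_smul C.Functions c t, TensorProduct.tmul_smul, map_smul,
        algebraMap_smul])

/-- The multiplication `H⁰(C, L) × H⁰(C, 𝒪_C) → H⁰(C, L)`. -/
def mulFunctions (L : C.X.Modules) : H0 L →ₗ[ℂ] C.Functions →ₗ[ℂ] H0 L :=
  (LinearMap.lsmul C.Functions (H0 L)).restrictScalars₁₂ ℂ ℂ |>.flip

/-- The Koszul cohomology group `K_{p,1}(C, L)`: the cohomology at the middle term of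
`H⁰(𝒪_C) ⊗ ⋀^{p+1} H⁰(L) → H⁰(L) ⊗ ⋀^p H⁰(L) → H⁰(L ⊗ L) ⊗ ⋀^{p-1} H⁰(L)`. -/
abbrev KoszulOne (p : ℕ) (L : C.X.Modules) : Type :=
  KoszulCohomology (mulFunctions L) (mulSections L L) p

end SmoothCurve

end

/-! The classes are determinantal syzygies attached to a pencil. Gonality at most i+1 gives
independent rational functions s, t whose poles are bounded by a divisor E of degree at most i+1. If
L ≅ 𝒪(D), then D − E has degree at least 3i+1, so Riemann's inequality (`divisorDegree_add_one_le`)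
yields independent b_0, …, b_i in its Riemann-Roch space. All s·b_j and t·b_j are then sections of
L, and the 2×2 minors of the matrix with these two rows vanish in H⁰(L ⊗ L), because products of
sections are determined by products of rational functions (`mulSections_eq_mulSections`). Hence for
every scalar l the element ∑ⱼ (-1)ʲ t b_j ⊗ ⋀_{k≠j} (s + l t) b_k is a Koszul cycle
(`koszulDifferential_minorSyzygy`). Any i distinct values of l give independent classes.

For independence, evaluate at points q_0, …, q_i. The cycle becomes t(q_0) · ∏_{a≥1} (s + l t)(q_a)
· det(b_j(q_a)). Since H⁰(𝒪) = ℂ, a boundary becomes an alternating function of the points. Adding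
the value with q_0 and q_1 exchanged kills boundaries and turns a combination of cycles with
coefficients c_l into A·B·det, where A = t(q_0)s(q_1) − t(q_1)s(q_0) and B = ∑ c_l ∏_{a≥2} (s + l
t)(q_a). The factor A is nonzero because s, t are independent, det because the b_j are, and B
because the i values of l are distinct and there are i−1 remaining points. The functions live on
powers of an irreducible object, so the product is nonzero (`linearIndependent_minorSyzygy`). -/

noncomputable section

/-! ### Smooth local rings of dimension one are discrete valuation rings. -/

section LocalAlgebra

open IsLocalRing KaehlerDifferential

variable {k R : Type*} [CommRing k] [CommRing R] [IsLocalRing R] [Algebra k R]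

/-- If `k` is the residue field of a local `k`-algebra `R`, then `r ↦ r - c(r)`, where
`c(r)` is the constant congruent to `r`, is a derivation with values in the cotangent space. -/
theorem exists_derivation_cotangentSpace
    (h : Function.Bijective (algebraMap k (ResidueField R))) :
    ∃ D : Derivation k R (CotangentSpace R), ∀ m : maximalIdeal R,
      D m = (maximalIdeal R).toCotangent m := by
  let e := RingEquiv.ofBijective _ h
  let c : R →+* k := e.symm.toRingHom.comp (residue R)
  have hc : ∀ r, algebraMap k (ResidueField R) (c r) = residue R r := fun r =>
    e.apply_symm_apply _
  have hck : ∀ a : k, c (algebraMap k R a) = a := fun a => h.1 (hc _)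
  have hmem : ∀ r, r - algebraMap k R (c r) ∈ maximalIdeal R := fun r => by
    rw [← residue_eq_zero_iff, map_sub, ← hc r, sub_eq_zero]
    rfl
  let ρ : R →ₗ[k] maximalIdeal R :=
    { toFun := fun r => ⟨_, hmem r⟩
      map_add' := fun r s => by ext; simp; ring
      map_smul' := fun a r => by ext; simp [Algebra.smul_def, hck]; ring }
  let D : Derivation k R (CotangentSpace R) := Derivation.mk'
    (((maximalIdeal R).toCotangent.restrictScalars k).comp ρ) (by
      intro r s
      -- The Leibniz rule fails only by (r − c r) · ρ s, a product of two elements of the maximal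
      -- ideal, which dies in the cotangent space.
      have : (ρ (r * s)) = r • ρ s + s • ρ r -
          (⟨r - algebraMap k R (c r), hmem r⟩ : maximalIdeal R).1 • ρ s := by
        ext
        simp [ρ]
        ring
      simp only [LinearMap.comp_apply, LinearMap.restrictScalars_apply, this, map_sub, map_add,
        map_smul]
      rw [sub_eq_self, ← map_smul, Ideal.toCotangent_eq_zero, pow_two]
      exact Ideal.mul_mem_mul (hmem r) (hmem s))
  refine ⟨D, fun m => ?_⟩
  have hm : c m = 0 := h.1 (by rw [hc, map_zero, residue_eq_zero_iff]; exact m.2)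
  change (maximalIdeal R).toCotangent (ρ m) = _
  congr 1
  ext
  simp [ρ, hm]

/-- The derivation onto the cotangent space factors through Ω, so a generator of Ω spans the
cotangent space. Its dimension is not 0: a field R would equal k, and then Ω would vanish. -/
theorem isDiscreteValuationRing_of_basis_kaehlerDifferential [IsNoetherianRing R] [IsDomain R]
    (h : Function.Bijective (algebraMap k (ResidueField R)))
    (b : Module.Basis Unit R Ω[R⁄k]) : IsDiscreteValuationRing R := by
  obtain ⟨D, hD⟩ := exists_derivation_cotangentSpace h
  have hfin : Module.finrank (ResidueField R) (CotangentSpace R) ≤ 1 := by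
    refine finrank_le_one (D.liftKaehlerDifferential (b ())) fun w => ?_
    obtain ⟨m, rfl⟩ := (maximalIdeal R).toCotangent_surjective w
    refine ⟨residue R (b.repr (KaehlerDifferential.D k R m) ()), ?_⟩
    have h1 := b.sum_repr (KaehlerDifferential.D k R m)
    rw [Fintype.sum_unique] at h1
    have h2 := congrArg D.liftKaehlerDifferential h1
    rw [map_smul, Derivation.liftKaehlerDifferential_comp_D, hD] at h2
    exact h2
  have hnf : ¬ IsField R := fun hf => by
    have hs : Function.Surjective (algebraMap k R) := fun r => by
      obtain ⟨a, ha⟩ := h.2 (residue R r)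
      refine ⟨a, ?_⟩
      have : residue R (algebraMap k R a - r) = 0 := by
        rw [map_sub, ← ha, sub_eq_zero]; rfl
      rw [residue_eq_zero_iff, isField_iff_maximalIdeal_eq.mp hf] at this
      exact sub_eq_zero.mp this
    have := KaehlerDifferential.subsingleton_of_surjective k R hs
    exact b.ne_zero () (Subsingleton.elim _ _)
  have h1 : Module.finrank (ResidueField R) (CotangentSpace R) = 1 := by
    refine le_antisymm hfin (Nat.one_le_iff_ne_zero.mpr ?_)
    rwa [Ne, finrank_cotangentSpace_eq_zero_iff]
  exact finrank_CotangentSpace_eq_one_iff.mp h1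

/-- Localization is formally étale, so Ω stays free of rank one when passing from A to R. -/
theorem isDiscreteValuationRing_of_isStandardSmooth [IsNoetherianRing R] [IsDomain R]
    (h : Function.Bijective (algebraMap k (ResidueField R)))
    (A : Type*) [CommRing A] [Algebra k A] [Algebra A R] [IsScalarTower k A R]
    [Algebra.IsStandardSmoothOfRelativeDimension 1 k A] (P : Ideal A) [P.IsPrime]
    [IsLocalization.AtPrime R P] : IsDiscreteValuationRing R := by
  have : Nontrivial A := (algebraMap A R).domain_nontrivial
  have := Algebra.IsStandardSmoothOfRelativeDimension.isStandardSmooth (R := k) (S := A) 1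
  have hr :=
    Algebra.IsStandardSmoothOfRelativeDimension.rank_kaehlerDifferential (R := k) (S := A) 1
  have : Algebra.FormallyEtale A R := Algebra.FormallyEtale.of_isLocalization P.primeCompl
  let b := Module.basisUnique (R := A) (M := Ω[A⁄k]) Unit
    (Module.finrank_eq_of_rank_eq (by simpa using hr))
  exact isDiscreteValuationRing_of_basis_kaehlerDifferential h
    ((b.baseChange R).map (KaehlerDifferential.tensorKaehlerEquivOfFormallyEtale k A R))

end LocalAlgebra

/-! ### Local rings of the curve at closed points. -/

namespace SmoothCurve

variable (C : SmoothCurve)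

/-- The structure map to the stalk. -/
def stalkScalars (x : C.X) : ℂ →+* C.X.presheaf.stalk x :=
  (C.X.presheaf.germ ⊤ x trivial).hom.comp C.scalars

theorem eq_residue_comp_stalkScalars (x : C.X) (φ : CommRingCat.of ℂ ⟶ C.X.residueField x)
    (h : Spec.map φ = C.X.fromSpecResidueField x ≫ C.π) :
    φ.hom = (C.X.residue x).hom.comp (C.stalkScalars x) := by
  have h3 := congrArg (fun f => (Scheme.ΓSpecIso (.of ℂ)).inv ≫ f.appTop ≫
    (Scheme.ΓSpecIso _).hom) h
  simp only [Scheme.fromSpecResidueField, Scheme.Hom.comp_appTop, Scheme.fromSpecStalk_appTop,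
    homOfLE_refl, op_id, CategoryTheory.Functor.map_id, Category.comp_id, Category.assoc,
    Scheme.ΓSpecIso_naturality, Iso.inv_hom_id_assoc] at h3
  rw [h3]
  rfl

theorem residue_stalkScalars_bijective (x : C.Point) :
    Function.Bijective ((C.X.residue x.1).hom.comp (C.stalkScalars x.1)) := by
  rw [← C.eq_residue_comp_stalkScalars x.1 _ (SpecMap_residueFieldIsoBase_inv C.π x.1 x.2)]
  exact (residueFieldIsoBase C.π x.1 x.2).symm.commRingCatIsoToRingEquiv.bijective

theorem isDiscreteValuationRing_stalk (x : C.Point) :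
    IsDiscreteValuationRing (C.X.presheaf.stalk x.1) := by
  obtain ⟨U, hU, V, hV, hxV, e, hstd⟩ :=
    SmoothOfRelativeDimension.exists_isStandardSmoothOfRelativeDimension (n := 1) (f := C.π) x.1
  have hne : C.π x.1 ∈ U := e hxV
  obtain rfl : U = ⊤ := by
    ext y
    have : Subsingleton (Spec (.of ℂ)) := inferInstanceAs (Subsingleton (PrimeSpectrum ℂ))
    simpa [Subsingleton.elim y (C.π x.1)] using hne
  let φ := (C.π.appLE ⊤ V e).hom
  let ψ : Γ(C.X, V) →+* C.X.presheaf.stalk x.1 := (C.X.presheaf.germ V x.1 hxV).hom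
  have hres : C.X.presheaf.germ ⊤ x.1 trivial = C.X.presheaf.map (homOfLE le_top).op ≫
      C.X.presheaf.germ V x.1 hxV := by simp
  let := φ.toAlgebra
  let : Algebra Γ(C.X, V) (C.X.presheaf.stalk x.1) :=
    TopCat.Presheaf.algebra_section_stalk C.X.presheaf (⟨x.1, hxV⟩ : V)
  let : Algebra Γ(Spec (.of ℂ), ⊤) (C.X.presheaf.stalk x.1) := (ψ.comp φ).toAlgebra
  have : IsScalarTower Γ(Spec (.of ℂ), ⊤) Γ(C.X, V) (C.X.presheaf.stalk x.1) :=
    IsScalarTower.of_algebraMap_eq' rfl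
  have : Algebra.IsStandardSmoothOfRelativeDimension 1 Γ(Spec (.of ℂ), ⊤) Γ(C.X, V) := hstd
  have := hV.isLocalization_stalk ⟨x.1, hxV⟩
  refine isDiscreteValuationRing_of_isStandardSmooth (k := Γ(Spec (.of ℂ), ⊤)) ?_ Γ(C.X, V)
    (hV.primeIdealOf ⟨x.1, hxV⟩).asIdeal
  have h1 := C.residue_stalkScalars_bijective x
  have h2 := (Scheme.ΓSpecIso (.of ℂ)).commRingCatIsoToRingEquiv.bijective
  have h3 := h1.comp h2
  change Function.Bijective (fun a => C.X.residue x.1 (ψ (φ a)))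
  convert h3 using 1
  funext a
  change _ = C.X.residue x.1 (C.X.presheaf.germ ⊤ x.1 trivial
    (((Scheme.ΓSpecIso (.of ℂ)).inv ≫ C.π.appTop) ((Scheme.ΓSpecIso (.of ℂ)).hom a)))
  rw [CommRingCat.comp_apply, Iso.hom_inv_id_apply, hres]
  congr 1

theorem coheight_point (x : C.Point) : Order.coheight x.1 = 1 := by
  have := C.isDiscreteValuationRing_stalk x
  have h := ringKrullDim_stalk_eq_coheight x.1
  rw [IsDiscreteValuationRing.ringKrullDim_eq_one] at h
  exact_mod_cast h.symm

end SmoothCurve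

theorem mem_range_algebraMap_stalk_iff {X : Scheme.{0}} [IsIntegral X] [IsLocallyNoetherian X]
    {x : X} [IsDiscreteValuationRing (X.presheaf.stalk x)] (hx : Order.coheight x = 1)
    {f : X.functionField} (hf : f ≠ 0) :
    f ∈ Set.range (algebraMap (X.presheaf.stalk x) X.functionField) ↔ 0 ≤ Scheme.ord f x := by
  rw [Scheme.le_ord_iff hx hf, ofAdd_zero, WithZero.coe_one]
  unfold Scheme.ordHom
  constructor
  · rintro ⟨r, rfl⟩
    exact Ring.ordFrac_ge_one_of_ne_zero (by rintro rfl; exact hf (map_zero _))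
  · intro h
    rw [Ring.ordFrac_eq_valuation_inv] at h
    obtain ⟨r, hr⟩ := IsDiscreteValuationRing.exists_lift_of_le_one
      ((one_le_inv₀ (by rw [WithZero.pos_iff_ne_zero]; simpa using hf)).mp h)
    exact ⟨r, hr⟩

/-! ### Orders of vanishing and spaces of bounded poles. -/

namespace SmoothCurve

variable (C : SmoothCurve)

/-- The order of vanishing of a rational function at a closed point. -/
def ordAt (x : C.Point) (f : C.K) : ℤ := Scheme.ord (X := C.X) f x.1

theorem ordAt_mul (x : C.Point) {f g : C.K} (hf : f ≠ 0) (hg : g ≠ 0) :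
    C.ordAt x (f * g) = C.ordAt x f + C.ordAt x g :=
  Scheme.ord_mul (X := C.X) hf hg

theorem ordAt_add (x : C.Point) {f g : C.K} (h : f + g ≠ 0) :
    min (C.ordAt x f) (C.ordAt x g) ≤ C.ordAt x (f + g) := by
  have := C.isDiscreteValuationRing_stalk x
  exact Scheme.ord_add (X := C.X) h

theorem mem_localRing_iff (x : C.Point) {f : C.K} (hf : f ≠ 0) :
    f ∈ C.localRing x ↔ 0 ≤ C.ordAt x f := by
  have := C.isDiscreteValuationRing_stalk x
  exact mem_range_algebraMap_stalk_iff (C.coheight_point x) hf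

theorem exists_ordAt_eq_one (x : C.Point) : ∃ f : C.K, f ≠ 0 ∧ C.ordAt x f = 1 := by
  have := C.isDiscreteValuationRing_stalk x
  obtain ⟨ϖ, hϖ⟩ := IsDiscreteValuationRing.exists_irreducible (C.X.presheaf.stalk x.1)
  have h0 : algebraMap _ C.X.functionField ϖ ≠ 0 :=
    (map_ne_zero_iff _ (IsFractionRing.injective _ _)).mpr hϖ.ne_zero
  refine ⟨algebraMap _ C.X.functionField ϖ, h0, ?_⟩
  unfold ordAt
  rw [Scheme.ord_eq_iff (C.coheight_point x) h0]
  exact Ring.ordFrac_irreducible hϖ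

theorem algebraMap_eq_stalkScalars (x : C.X) (c : ℂ) :
    algebraMap ℂ C.K c = algebraMap (C.X.presheaf.stalk x) C.X.functionField
      (C.stalkScalars x c) := by
  exact (C.X.algebraMap_germ_eq_germToFunctionField (U := ⊤) trivial _).symm

theorem ordAt_algebraMap (x : C.Point) {c : ℂ} (hc : c ≠ 0) :
    C.ordAt x (algebraMap ℂ C.K c) = 0 := by
  have : IsUnit (show Γ(C.X, ⊤) from C.scalars c) := (IsUnit.mk0 c hc).map C.scalars
  exact Scheme.ord_of_isUnit (X := C.X) (U := ⊤) this trivial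

/-- A function regular at `x` is congruent to a constant modulo functions vanishing at `x`. -/
theorem exists_sub_algebraMap (x : C.Point) {f : C.K} (hf : f ≠ 0) (h : 0 ≤ C.ordAt x f) :
    ∃ c : ℂ, f - algebraMap ℂ C.K c ≠ 0 → 1 ≤ C.ordAt x (f - algebraMap ℂ C.K c) := by
  have := C.isDiscreteValuationRing_stalk x
  obtain ⟨r, rfl⟩ := (C.mem_localRing_iff x hf).mpr h
  obtain ⟨c, hc⟩ := (C.residue_stalkScalars_bijective x).2 (C.X.residue x.1 r)
  refine ⟨c, ?_⟩
  rw [C.algebraMap_eq_stalkScalars x.1 c]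
  suffices H : ∀ g : C.K, g = algebraMap (C.X.presheaf.stalk x.1) C.X.functionField
      (r - C.stalkScalars x.1 c) → g ≠ 0 → 1 ≤ C.ordAt x g from H _ (map_sub _ _ _).symm
  rintro g rfl h0
  have h1 := (C.mem_localRing_iff x h0).mp ⟨_, rfl⟩
  refine Int.add_one_le_iff.mpr (lt_of_le_of_ne h1 fun h2 => ?_)
  have h3 := (Scheme.ord_eq_iff (C.coheight_point x) h0).mp h2.symm
  have h4 := (Ring.isUnit_iff_ordFrac_one_of_isDiscreteValuationRing
    (K := C.X.functionField)).mpr h3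
  have h5 : C.X.residue x.1 (r - C.stalkScalars x.1 c) = 0 := by
    rw [map_sub, sub_eq_zero]; exact hc.symm
  have h6 := h4.map (C.X.residue x.1).hom
  exact h6.ne_zero h5

/-- The rational functions with `ord_x f ≥ -n`. -/
def poleSpace (x : C.Point) (n : ℤ) : Submodule ℂ C.K where
  carrier := {f | f ≠ 0 → 0 ≤ C.ordAt x f + n}
  add_mem' := by
    intro f g hf hg h
    by_cases h1 : f = 0
    · subst h1; simpa using hg (by simpa using h)
    by_cases h2 : g = 0
    · subst h2; simpa using hf (by simpa using h)
    have := C.ordAt_add x h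
    have := hf h1
    have := hg h2
    omega
  zero_mem' := fun h => (h rfl).elim
  smul_mem' := by
    intro c f hf h
    rw [Algebra.smul_def] at h ⊢
    obtain ⟨h1, h2⟩ := mul_ne_zero_iff.mp h
    rw [C.ordAt_mul x h1 h2, C.ordAt_algebraMap x (by rintro rfl; exact h1 (map_zero _)), zero_add]
    exact hf h2

theorem mem_poleSpace {x : C.Point} {n : ℤ} {f : C.K} :
    f ∈ C.poleSpace x n ↔ (f ≠ 0 → 0 ≤ C.ordAt x f + n) := Iff.rfl

theorem poleSpace_zero (x : C.Point) : C.poleSpace x 0 = C.localRing x := by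
  ext f
  by_cases hf : f = 0
  · simp [hf]
  · simp [mem_poleSpace, C.mem_localRing_iff x hf, hf]

theorem poleSpace_mono (x : C.Point) {m n : ℤ} (h : m ≤ n) :
    C.poleSpace x m ≤ C.poleSpace x n := fun f hf h0 => by
  have := hf h0
  omega

end SmoothCurve

/-! ### Rational functions regular everywhere are constant. -/

namespace SmoothCurve

variable (C : SmoothCurve)

/-- Properness makes the global functions a finite ℂ-algebra; being a domain over an algebraically
closed field, it is ℂ. -/
theorem scalars_surjective : Function.Surjective C.scalars := by
  have h1 := finite_appTop_of_universallyClosed ℂ C.π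
  have h2 : C.scalars.IsIntegral := by
    apply RingHom.isIntegral_respectsIso.2 (e := (Scheme.ΓSpecIso _).symm.commRingCatIsoToRingEquiv)
    exact h1.to_isIntegral
  have : IsDomain C.Functions := inferInstanceAs (IsDomain Γ(C.X, ⊤))
  exact (IsAlgClosed.ringHom_bijective_of_isIntegral _ h2).2

theorem exists_section_of_forall_mem_localRing {f : C.K} (hf : ∀ x : C.Point, f ∈ C.localRing x) :
    ∃ s : Γ(C.X, ⊤), C.X.germToFunctionField ⊤ s = f := by
  let ι := {p : Σ U : C.X.Opens, Γ(C.X, U) // ∃ h : genericPoint C.X ∈ p.1,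
    C.X.presheaf.germ p.1 _ h p.2 = f}
  -- By quasi-compactness a nonempty closed complement of the domain of f would contain a closed
  -- point, but f is regular at all of those.
  have hcov : (⊤ : C.X.Opens) ≤ iSup fun i : ι => i.1.1 := by
    by_contra hne
    have : CompactSpace C.X := (quasiCompact_iff_compactSpace C.π).mp inferInstance
    obtain ⟨x, hx, hxc⟩ := IsClosed.exists_closed_singleton
      (S := ((iSup fun i : ι => i.1.1 : C.X.Opens) : Set C.X)ᶜ)
      (iSup fun i : ι => i.1.1 : C.X.Opens).2.isClosed_compl (by
        rw [Set.nonempty_compl]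
        exact fun h => hne fun y _ => by
          rw [← SetLike.mem_coe, h]; trivial)
    obtain ⟨r, hr⟩ := hf ⟨x, hxc⟩
    obtain ⟨U, hU, s, rfl⟩ := C.X.presheaf.exists_germ_eq r
    have hne : Nonempty U := ⟨⟨x, hU⟩⟩
    have hη : genericPoint C.X ∈ U := (genericPoint_spec C.X).mem_open_set_iff U.2 |>.mpr
      ⟨x, trivial, hU⟩
    refine hx (TopologicalSpace.Opens.mem_iSup.mpr ⟨⟨⟨U, s⟩, hη, ?_⟩, hU⟩)
    rw [← hr, C.X.algebraMap_germ_eq_germToFunctionField hU]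
  obtain ⟨s, hs, -⟩ := C.X.sheaf.existsUnique_gluing' (fun i : ι => i.1.1) ⊤
    (fun i => homOfLE le_top) hcov
    (fun i => i.1.2) (by
      intro i j
      obtain ⟨h1, h2⟩ := i.2
      obtain ⟨h3, h4⟩ := j.2
      refine germ_injective_of_isIntegral C.X (genericPoint C.X) (U := i.1.1 ⊓ j.1.1) ⟨h1, h3⟩ ?_
      erw [C.X.presheaf.germ_res_apply, C.X.presheaf.germ_res_apply]
      exact h2.trans h4.symm)
  obtain ⟨i, hi⟩ := TopologicalSpace.Opens.mem_iSup.mp (hcov (x := genericPoint C.X) trivial)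
  obtain ⟨h1, h2⟩ := i.2
  refine ⟨s, ?_⟩
  rw [← h2, ← hs i]
  exact (C.X.presheaf.germ_res_apply (homOfLE le_top) _ h1 s).symm

theorem exists_algebraMap_eq_of_forall_mem_localRing {f : C.K}
    (hf : ∀ x : C.Point, f ∈ C.localRing x) : ∃ c : ℂ, algebraMap ℂ C.K c = f := by
  obtain ⟨s, rfl⟩ := C.exists_section_of_forall_mem_localRing hf
  obtain ⟨c, rfl⟩ := C.scalars_surjective s
  exact ⟨c, rfl⟩

end SmoothCurve

/-! ### Riemann-Roch spaces and Riemann's inequality. -/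

namespace SmoothCurve

variable (C : SmoothCurve)

theorem exists_ordAt_eq (x : C.Point) (n : ℤ) : ∃ f : C.K, f ≠ 0 ∧ C.ordAt x f = n := by
  obtain ⟨ϖ, h0, h1⟩ := C.exists_ordAt_eq_one x
  have hone : C.ordAt x 1 = 0 := by
    simpa using C.ordAt_algebraMap x (one_ne_zero : (1 : ℂ) ≠ 0)
  have hnat : ∀ m : ℕ, C.ordAt x (ϖ ^ m) = m := by
    intro m
    induction m with
    | zero => simpa using hone
    | succ m ih => rw [pow_succ, C.ordAt_mul x (pow_ne_zero _ h0) h0, ih, h1]; push_cast; ring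
  have hinv : ∀ f : C.K, f ≠ 0 → C.ordAt x f⁻¹ = - C.ordAt x f := by
    intro f hf
    have := C.ordAt_mul x hf (inv_ne_zero hf)
    rw [mul_inv_cancel₀ hf, hone] at this
    omega
  obtain ⟨m, rfl | rfl⟩ := n.eq_nat_or_neg
  · exact ⟨ϖ ^ m, pow_ne_zero _ h0, hnat m⟩
  · exact ⟨(ϖ ^ m)⁻¹, inv_ne_zero (pow_ne_zero _ h0), by rw [hinv _ (pow_ne_zero _ h0), hnat]⟩

/-- `poleSpace x (n + 1)` is generated over `poleSpace x n` by any function with a pole of order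
exactly `n + 1`. -/
theorem exists_sub_smul_mem_poleSpace (x : C.Point) {n : ℤ} {e f : C.K}
    (he : e ∈ C.poleSpace x (n + 1)) (he' : e ∉ C.poleSpace x n) (hf : f ∈ C.poleSpace x (n + 1)) :
    ∃ c : ℂ, f - c • e ∈ C.poleSpace x n := by
  rw [mem_poleSpace, Classical.not_imp] at he'
  obtain ⟨h0, h1⟩ := he'
  have he1 : C.ordAt x e = - (n + 1) := by
    have := he h0
    omega
  by_cases hf0 : f = 0
  · exact ⟨0, by simp [hf0]⟩
  have hq : f / e ≠ 0 := div_ne_zero hf0 h0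
  have hfe : C.ordAt x f = C.ordAt x (f / e) + C.ordAt x e := by
    rw [← C.ordAt_mul x hq h0, div_mul_cancel₀ _ h0]
  -- As e has a pole of order exactly n + 1, the quotient f / e is regular at x, and c is its value
  -- there.
  obtain ⟨c, hc⟩ := C.exists_sub_algebraMap x hq (by have := hf hf0; omega)
  refine ⟨c, fun h => ?_⟩
  have hmul : f - c • e = (f / e - algebraMap ℂ C.K c) * e := by
    rw [Algebra.smul_def, sub_mul, div_mul_cancel₀ _ h0]
  rw [hmul] at h ⊢
  have h2 := (mul_ne_zero_iff.mp h).1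
  rw [C.ordAt_mul x h2 h0]
  have := hc h2
  omega

theorem exists_mem_poleSpace_succ (x : C.Point) (n : ℤ) :
    ∃ e ∈ C.poleSpace x (n + 1), e ∉ C.poleSpace x n := by
  obtain ⟨e, h0, h1⟩ := C.exists_ordAt_eq x (-(n + 1))
  refine ⟨e, fun _ => by omega, fun h => ?_⟩
  have := h h0
  omega

/-- Families `(f_x)` of rational functions with `ord_x f_x ≥ -D(x)` for all `x`. -/
def adeleSpace (D : C.Divisor) : Submodule ℂ (C.Point → C.K) :=
  Submodule.pi Set.univ fun x => C.poleSpace x (D x)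

theorem mem_adeleSpace {D : C.Divisor} {f : C.Point → C.K} :
    f ∈ C.adeleSpace D ↔ ∀ x, f x ∈ C.poleSpace x (D x) := by simp [adeleSpace]

/-- The Riemann-Roch space `H⁰(C, 𝒪_C(D))` inside the function field. -/
def riemannRochSpace (D : C.Divisor) : Submodule ℂ C.K := ⨅ x, C.poleSpace x (D x)

theorem mem_riemannRochSpace {D : C.Divisor} {f : C.K} :
    f ∈ C.riemannRochSpace D ↔ ∀ x, f ∈ C.poleSpace x (D x) := by simp [riemannRochSpace]

theorem riemannRochSpace_mono {D E : C.Divisor} (h : D ≤ E) :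
    C.riemannRochSpace D ≤ C.riemannRochSpace E := fun f hf => by
  rw [mem_riemannRochSpace] at *
  exact fun x => C.poleSpace_mono x (h x) (hf x)

theorem adeleSpace_mono {D E : C.Divisor} (h : D ≤ E) :
    C.adeleSpace D ≤ C.adeleSpace E := fun f hf => by
  rw [mem_adeleSpace] at *
  exact fun x => C.poleSpace_mono x (h x) (hf x)

theorem adeleSpace_zero : C.adeleSpace 0 = C.integralAdeles := by
  simp [adeleSpace, integralAdeles, poleSpace_zero]

theorem adeleSpace_le_adeles (D : C.Divisor) : C.adeleSpace D ≤ C.adeles := fun f hf => by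
  refine D.support.finite_toSet.subset fun x hx => ?_
  by_contra h
  have := C.mem_adeleSpace.mp hf x
  rw [Finsupp.notMem_support_iff.mp h, poleSpace_zero] at this
  exact hx this

instance : Module.Finite ℂ (C.riemannRochSpace 0) := by
  have h : C.riemannRochSpace 0 ≤ Submodule.span ℂ {(1 : C.K)} := fun f hf => by
    rw [mem_riemannRochSpace] at hf
    obtain ⟨c, rfl⟩ := C.exists_algebraMap_eq_of_forall_mem_localRing (f := f) fun x => by
      simpa [← poleSpace_zero] using hf x
    exact Submodule.mem_span_singleton.mpr ⟨c, by rw [Algebra.smul_def, mul_one]⟩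
  exact Submodule.finiteDimensional_of_le h

theorem one_mem_riemannRochSpace_zero : (1 : C.K) ∈ C.riemannRochSpace 0 := by
  rw [mem_riemannRochSpace]
  intro x _
  have := C.ordAt_algebraMap x (one_ne_zero : (1 : ℂ) ≠ 0)
  rw [map_one] at this
  simp [this]

theorem le_add_single (D : C.Divisor) (x : C.Point) : D ≤ D + Finsupp.single x 1 :=
  le_add_of_nonneg_right (Finsupp.single_nonneg.mpr zero_le_one)

theorem exists_sub_smul_mem_riemannRochSpace {D : C.Divisor} {x : C.Point} {e f : C.K}
    (he : e ∈ C.riemannRochSpace (D + Finsupp.single x 1)) (he' : e ∉ C.riemannRochSpace D)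
    (hf : f ∈ C.riemannRochSpace (D + Finsupp.single x 1)) :
    ∃ c : ℂ, f - c • e ∈ C.riemannRochSpace D := by
  rw [mem_riemannRochSpace] at he hf
  have aux : ∀ g : C.K, (∀ y, g ∈ C.poleSpace y ((D + Finsupp.single x 1 : C.Divisor) y)) →
      g ∈ C.poleSpace x (D x) → g ∈ C.riemannRochSpace D := by
    intro g hg hgx
    rw [mem_riemannRochSpace]
    intro y
    by_cases hy : y = x
    · exact hy ▸ hgx
    · simpa [Finsupp.single_apply, Ne.symm hy] using hg y
  obtain ⟨c, hc⟩ := C.exists_sub_smul_mem_poleSpace x (n := D x) (by simpa using he x)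
    (fun h => he' (aux e he h)) (by simpa using hf x)
  exact ⟨c, aux _ (fun y => Submodule.sub_mem _ (hf y) (Submodule.smul_mem _ _ (he y))) hc⟩

theorem riemannRochSpace_add_single_le (D : C.Divisor) (x : C.Point) :
    ∃ e, C.riemannRochSpace (D + Finsupp.single x 1) ≤
      C.riemannRochSpace D ⊔ Submodule.span ℂ {e} := by
  by_cases h : C.riemannRochSpace (D + Finsupp.single x 1) ≤ C.riemannRochSpace D
  · exact ⟨0, h.trans le_sup_left⟩
  obtain ⟨e, he, he'⟩ := SetLike.not_le_iff_exists.mp h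
  refine ⟨e, fun f hf => ?_⟩
  obtain ⟨c, hc⟩ := C.exists_sub_smul_mem_riemannRochSpace he he' hf
  exact Submodule.mem_sup.mpr ⟨_, hc, c • e, Submodule.smul_mem _ _
    (Submodule.mem_span_singleton_self e), by simp⟩

theorem effective_induction {motive : C.Divisor → Prop} (zero : motive 0)
    (step : ∀ D x, 0 ≤ D → motive D → motive (D + Finsupp.single x 1)) :
    ∀ D, 0 ≤ D → motive D := by
  have hn : ∀ (n : ℕ) D x, 0 ≤ D → motive D → motive (D + Finsupp.single x (n : ℤ)) := by
    intro n D x hD h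
    induction n with
    | zero => simpa using h
    | succ n ih =>
      have := step _ x (add_nonneg hD (Finsupp.single_nonneg.mpr (Int.natCast_nonneg n))) ih
      rwa [add_assoc, ← Finsupp.single_add] at this
  intro D
  induction D using Finsupp.induction with
  | zero => exact fun _ => zero
  | single_add a b f ha hb ih =>
    intro h
    have hb0 : 0 ≤ b := by
      have := h a
      simpa [Finsupp.notMem_support_iff.mp ha] using this
    have hf0 : 0 ≤ f := fun y => by
      by_cases hy : y = a
      · subst hy; simp [Finsupp.notMem_support_iff.mp ha]
      · simpa [Finsupp.single_apply, Ne.symm hy] using h y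
    obtain ⟨n, rfl⟩ := Int.eq_ofNat_of_zero_le hb0
    rw [add_comm]
    exact hn n f a hf0 (ih hf0)

/-- Start from the constants; each added point costs at most one dimension, and D is bounded by the
effective divisor D ⊔ 0. -/
instance finite_riemannRochSpace (D : C.Divisor) : Module.Finite ℂ (C.riemannRochSpace D) := by
  have h : ∀ E : C.Divisor, 0 ≤ E → Module.Finite ℂ (C.riemannRochSpace E) := by
    refine C.effective_induction inferInstance fun E x _ hE => ?_
    obtain ⟨e, he⟩ := C.riemannRochSpace_add_single_le E x
    exact Submodule.finiteDimensional_of_le he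
  have := h (D ⊔ 0) le_sup_right
  exact Submodule.finiteDimensional_of_le (C.riemannRochSpace_mono (le_sup_left : D ≤ D ⊔ 0))

theorem divisorDegree_add (D E : C.Divisor) :
    C.divisorDegree (D + E) = C.divisorDegree D + C.divisorDegree E :=
  Finsupp.sum_add_index' (fun _ => rfl) fun _ _ _ => rfl

theorem divisorDegree_single (x : C.Point) (n : ℤ) :
    C.divisorDegree (Finsupp.single x n) = n := Finsupp.sum_single_index rfl

theorem finrank_riemannRochSpace_add_single_le (D : C.Divisor) (x : C.Point) :
    Module.finrank ℂ (C.riemannRochSpace (D + Finsupp.single x 1)) ≤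
      Module.finrank ℂ (C.riemannRochSpace D) + 1 := by
  obtain ⟨e, he⟩ := C.riemannRochSpace_add_single_le D x
  calc _ ≤ _ := Submodule.finrank_mono he
    _ ≤ _ := Submodule.finrank_add_le_finrank_add_finrank _ _
    _ ≤ _ := Nat.add_le_add_left (by
      simpa [Set.finrank] using finrank_span_le_card (R := ℂ) ({e} : Set C.K)) _

theorem finrank_riemannRochSpace_le_sub {F : C.Divisor} (hF : 0 ≤ F) : ∀ D : C.Divisor,
    (Module.finrank ℂ (C.riemannRochSpace D) : ℤ) ≤
      Module.finrank ℂ (C.riemannRochSpace (D - F)) + C.divisorDegree F := by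
  revert F
  refine fun {F} => C.effective_induction (motive := fun F => ∀ D : C.Divisor,
    (Module.finrank ℂ (C.riemannRochSpace D) : ℤ) ≤
      Module.finrank ℂ (C.riemannRochSpace (D - F)) + C.divisorDegree F) ?_ ?_ F
  · intro D
    rw [sub_zero]
    simp [divisorDegree]
  · intro F x hF ih D
    have h1 := ih D
    have h2 := C.finrank_riemannRochSpace_add_single_le (D - (F + Finsupp.single x 1)) x
    rw [show D - (F + Finsupp.single x 1) + Finsupp.single x 1 = D - F by abel] at h2
    rw [divisorDegree_add, divisorDegree_single]
    omega

/-- The subspace of families whose cokernel (inside the adeles) is `H¹(C, 𝒪_C(D))`. -/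
def adelePrincipalSpace (D : C.Divisor) : Submodule ℂ (C.Point → C.K) :=
  C.adeleSpace D ⊔ C.principalAdeles

/-- Raising an effective divisor by one point raises either `h⁰` or the number of adeles
independent modulo `integralAdeles ⊔ principalAdeles`. -/
theorem exists_linearIndependent_adeles : ∀ D : C.Divisor, 0 ≤ D →
    ∃ (n : ℕ) (v : Fin n → (C.Point → C.K)), (∀ j, v j ∈ C.adeleSpace D) ∧
      LinearIndependent ℂ ((C.adelePrincipalSpace 0).mkQ ∘ v) ∧
      C.divisorDegree D + 1 ≤ Module.finrank ℂ (C.riemannRochSpace D) + n := by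
  classical
  refine C.effective_induction ?_ ?_
  · refine ⟨0, Fin.elim0, fun j => j.elim0, linearIndependent_empty_type, ?_⟩
    have : 1 ≤ Module.finrank ℂ (C.riemannRochSpace 0) := by
      rw [Nat.one_le_iff_ne_zero, Ne, Submodule.finrank_eq_zero]
      intro h
      have := C.one_mem_riemannRochSpace_zero
      rw [h, Submodule.mem_bot] at this
      exact one_ne_zero this
    simp only [divisorDegree, Finsupp.sum_zero_index]
    omega
  · rintro D x hD ⟨n, v, hv, hind, hdeg⟩
    have hmono := C.adeleSpace_mono (C.le_add_single D x)
    obtain ⟨e, he, he'⟩ := C.exists_mem_poleSpace_succ x (D x)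
    let u : C.Point → C.K := Pi.single x e
    have hu : u ∈ C.adeleSpace (D + Finsupp.single x 1) := by
      rw [mem_adeleSpace]
      intro y
      by_cases hy : y = x
      · subst hy; simpa [u] using he
      · simp [u, hy]
    rw [divisorDegree_add, divisorDegree_single]
    -- The adele u is concentrated at x, with a pole one worse than D allows. If a principal adele f
    -- corrects it to one bounded by D, then f is a new element of the Riemann-Roch space; otherwise
    -- u itself is a new independent adele.
    by_cases hS : u ∈ C.adelePrincipalSpace D
    · obtain ⟨a, ha, _, ⟨f, rfl⟩, haf⟩ := Submodule.mem_sup.mp hS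
      have hfa : ∀ y, f = u y - a y := fun y => by
        rw [← haf]
        simp
      have hf : f ∈ C.riemannRochSpace (D + Finsupp.single x 1) := by
        rw [mem_riemannRochSpace]
        intro y
        rw [hfa y]
        exact Submodule.sub_mem _ (C.mem_adeleSpace.mp hu y) (C.mem_adeleSpace.mp (hmono ha) y)
      have hf' : f ∉ C.riemannRochSpace D := fun h => he' <| by
        have h1 := Submodule.add_mem _ (C.mem_riemannRochSpace.mp h x) (C.mem_adeleSpace.mp ha x)
        rw [hfa x] at h1
        simpa [u] using h1
      have hlt : C.riemannRochSpace D < C.riemannRochSpace (D + Finsupp.single x 1) :=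
        lt_of_le_of_ne (C.riemannRochSpace_mono (C.le_add_single D x)) fun h => hf' (h ▸ hf)
      have := Submodule.finrank_lt_finrank_of_lt hlt
      exact ⟨n, v, fun j => hmono (hv j), hind, by omega⟩
    · refine ⟨n + 1, Fin.cons u v, ?_, ?_, ?_⟩
      · intro j
        refine Fin.cases hu (fun j => ?_) j
        exact hmono (hv j)
      · rw [Fin.comp_cons, linearIndependent_finCons]
        refine ⟨hind, fun h => hS ?_⟩
        have h0 : C.adelePrincipalSpace 0 ≤ C.adelePrincipalSpace D :=
          sup_le_sup_right (C.adeleSpace_mono hD) _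
        have h1 : Submodule.span ℂ (Set.range ((C.adelePrincipalSpace 0).mkQ ∘ v)) ≤
            (C.adelePrincipalSpace D).map (C.adelePrincipalSpace 0).mkQ := by
          rw [Submodule.span_le]
          rintro _ ⟨j, rfl⟩
          exact ⟨v j, Submodule.mem_sup_left (hv j), rfl⟩
        obtain ⟨w, hw, hwu⟩ := h1 h
        rw [Submodule.mkQ_apply, Submodule.mkQ_apply, Submodule.Quotient.eq] at hwu
        simpa using Submodule.sub_mem _ hw (h0 hwu)
      · have := Submodule.finrank_mono (C.riemannRochSpace_mono (C.le_add_single D x))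
        push_cast
        omega

/-- **Riemann's inequality**. -/
theorem divisorDegree_add_one_le [Module.Finite ℂ C.H1] (D : C.Divisor) :
    C.divisorDegree D + 1 ≤ Module.finrank ℂ (C.riemannRochSpace D) + C.genus := by
  have heff : ∀ E : C.Divisor, 0 ≤ E →
      C.divisorDegree E + 1 ≤ Module.finrank ℂ (C.riemannRochSpace E) + C.genus := by
    intro E hE
    obtain ⟨n, v, hv, hind, hdeg⟩ := C.exists_linearIndependent_adeles E hE
    -- The n adeles stay independent in H¹, so n is at most the genus.
    let w : Fin n → C.H1 := fun j => Submodule.Quotient.mk ⟨v j, C.adeleSpace_le_adeles E (hv j)⟩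
    have hle : C.integralAdeles ⊔ C.principalAdeles ≤ C.adelePrincipalSpace 0 := by
      rw [adelePrincipalSpace, adeleSpace_zero]
    have hw : LinearIndependent ℂ w := LinearIndependent.of_comp
      (Submodule.mapQ _ (C.adelePrincipalSpace 0) C.adeles.subtype
        (fun a ha => hle (Submodule.mem_comap.mp ha))) hind
    have := hw.fintype_card_le_finrank
    rw [Fintype.card_fin] at this
    unfold genus
    omega
  -- For general D, removing the effective divisor D ⊔ 0 − D from D ⊔ 0 lowers h⁰ by at most its
  -- degree.
  have h1 := heff (D ⊔ 0) le_sup_right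
  have h2 : 0 ≤ D ⊔ 0 - D := sub_nonneg.mpr le_sup_left
  have h3 := C.finrank_riemannRochSpace_le_sub h2 (D ⊔ 0)
  rw [sub_sub_cancel] at h3
  have h4 := C.divisorDegree_add D (D ⊔ 0 - D)
  rw [add_sub_cancel] at h4
  omega

end SmoothCurve

/-! ### Determinantal cycles and a test for boundaries. -/

section Syzygies

variable {k V N : Type*} [CommRing k] [AddCommGroup V] [Module k V] [AddCommGroup N] [Module k N]

/-- The element `∑ⱼ (-1)ʲ yⱼ ⊗ w₀ ∧ … ŵⱼ … ∧ w_p` of `V ⊗ ⋀^p V`. -/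
def minorSyzygy {p : ℕ} (y w : Fin (p + 1) → V) : V ⊗[k] (⋀[k]^p V) :=
  ∑ j : Fin (p + 1), (-1 : ℤ) ^ (j : ℕ) • (y j ⊗ₜ[k] exteriorPower.ιMulti k p (j.removeNth w))

-- The hypothesis is the vanishing of the 2×2 minors of the matrix with rows w and y. Deleting two
-- indices in either order leaves the same wedge with opposite signs, and the symmetry makes the
-- coefficients agree, so the terms cancel in pairs.
open Fin in
theorem koszulDifferential_minorSyzygy (μ : V →ₗ[k] V →ₗ[k] N) {p : ℕ} (y w : Fin (p + 2) → V)
    (h : ∀ i j, μ (w i) (y j) = μ (w j) (y i)) :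
    koszulDifferential μ p (minorSyzygy y w) = 0 := by
  simp only [minorSyzygy, map_sum, map_zsmul, koszulDifferential_tmul_ιMulti, Finset.smul_sum,
    sum_sum_eq_sum_triangle_add, val_castSucc, val_succ]
  refine Finset.sum_eq_zero fun i _ => Finset.sum_eq_zero fun j hj => ?_
  rw [Finset.mem_Ici] at hj
  have H₁ : i.castSucc.removeNth w j = w j.succ := by
    simp [Fin.removeNth_apply, Fin.succAbove_of_le_castSucc, hj]
  have H₂ : j.succ.removeNth w i = w i.castSucc := by
    simp [Fin.removeNth_apply, Fin.succAbove_of_castSucc_lt, hj]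
  have H₃ : j.removeNth (i.castSucc.removeNth w) = i.removeNth (j.succ.removeNth w) := by
    rw [removeNth_removeNth_eq_swap]
    simp [Fin.predAbove, Fin.succAbove, hj.not_gt]
  rw [H₁, H₂, H₃, h j.succ i.castSucc, smul_smul, smul_smul, ← add_smul]
  have : (-1 : ℤ) ^ (i : ℕ) * (-1) ^ (j : ℕ) + (-1) ^ ((j : ℕ) + 1) * (-1) ^ (i : ℕ) = 0 := by ring
  rw [this, zero_smul]

/-- The functional `v ⊗ u₀ ∧ … ∧ u_{p-1} ↦ e₀(v) det(e_{a+1}(u_b))` on `V ⊗ ⋀^p V`. -/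
def evalMinors {p : ℕ} (e : Fin (p + 1) → V →ₗ[k] k) : V ⊗[k] (⋀[k]^p V) →ₗ[k] k :=
  LinearMap.mul' k k ∘ₗ TensorProduct.map (e 0) (exteriorPower.alternatingMapLinearEquiv
    (Matrix.detRowAlternating.compLinearMap (LinearMap.pi fun a : Fin p => e a.succ)))

theorem evalMinors_tmul_ιMulti {p : ℕ} (e : Fin (p + 1) → V →ₗ[k] k) (v : V) (u : Fin p → V) :
    evalMinors e (v ⊗ₜ exteriorPower.ιMulti k p u) =
      e 0 v * (Matrix.of fun b a => e a.succ (u b)).det := by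
  simp [evalMinors]
  rfl

/-- Laplace expansion along the first column, the only one that sees y. -/
theorem evalMinors_minorSyzygy {p : ℕ} (e : Fin (p + 1) → V →ₗ[k] k) (y w : Fin (p + 1) → V) :
    evalMinors e (minorSyzygy y w) =
      (Matrix.of fun b => (Fin.cons (e 0 (y b)) fun a : Fin p => e a.succ (w b) :
        Fin (p + 1) → k)).det := by
  rw [Matrix.det_succ_column_zero, minorSyzygy, map_sum]
  refine Finset.sum_congr rfl fun j _ => ?_
  rw [map_zsmul, evalMinors_tmul_ιMulti, zsmul_eq_mul]
  push_cast
  rw [mul_assoc]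
  rfl

theorem evalMinors_koszulDifferential {M : Type*} [AddCommGroup M] [Module k M]
    (μ : V →ₗ[k] M →ₗ[k] V) {p : ℕ} (e : Fin (p + 1) → V →ₗ[k] k) {m : M} {c : k}
    (hm : ∀ v, μ v m = c • v) (u : Fin (p + 1) → V) :
    evalMinors e (koszulDifferential μ p (m ⊗ₜ exteriorPower.ιMulti k (p + 1) u)) =
      c * (Matrix.of fun b a => e a (u b)).det := by
  have : koszulDifferential μ p (m ⊗ₜ exteriorPower.ιMulti k (p + 1) u) =
      c • minorSyzygy u u := by
    rw [koszulDifferential_tmul_ιMulti, minorSyzygy, Finset.smul_sum]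
    refine Finset.sum_congr rfl fun j _ => ?_
    rw [hm, ← TensorProduct.smul_tmul', smul_comm]
  rw [this, map_smul, evalMinors_minorSyzygy, smul_eq_mul]
  congr 3
  ext b a
  refine Fin.cases ?_ (fun a => ?_) a <;> simp

/-- When M acts by scalars, a boundary evaluates to multiples of det(e_a(u_b)), which changes sign
under a transposition of the functionals. Cycles that fail this antisymmetry are not boundaries. -/
theorem evalMinors_add_evalMinors_swap_eq_zero {M : Type*} [AddCommGroup M] [Module k M]
    (μ : V →ₗ[k] M →ₗ[k] V) (hμ : ∀ m, ∃ c : k, ∀ v, μ v m = c • v) {p : ℕ}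
    (e : Fin (p + 1) → V →ₗ[k] k) {a b : Fin (p + 1)} (hab : a ≠ b)
    {z : V ⊗[k] (⋀[k]^p V)} (hz : z ∈ LinearMap.range (koszulDifferential μ p)) :
    evalMinors e z + evalMinors (e ∘ Equiv.swap a b) z = 0 := by
  obtain ⟨z, rfl⟩ := hz
  induction z using TensorProduct.induction_on with
  | zero => simp
  | add z₁ z₂ h₁ h₂ => rw [map_add, map_add, map_add]; linear_combination h₁ + h₂
  | tmul m z =>
    obtain ⟨c, hc⟩ := hμ m
    have hzs : z ∈ Submodule.span k (Set.range (exteriorPower.ιMulti k (p + 1) (M := V))) := by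
      rw [exteriorPower.ιMulti_span]; trivial
    induction hzs using Submodule.span_induction with
    | zero => simp
    | add z₁ z₂ _ _ h₁ h₂ =>
      rw [TensorProduct.tmul_add, map_add, map_add, map_add]; linear_combination h₁ + h₂
    | smul r z _ h =>
      rw [TensorProduct.tmul_smul, map_smul, map_smul, map_smul, ← smul_add, h, smul_zero]
    | mem z hz =>
      obtain ⟨u, rfl⟩ := hz
      rw [evalMinors_koszulDifferential μ e hc, evalMinors_koszulDifferential μ _ hc]
      have := Matrix.det_permute' (Equiv.swap a b) (Matrix.of fun b a => e a (u b))
      rw [Equiv.Perm.sign_swap hab] at this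
      have h2 : (Matrix.of fun i j => (e ∘ Equiv.swap a b) j (u i)) =
        (Matrix.of fun b a => e a (u b)).submatrix id (Equiv.swap a b) := rfl
      rw [h2, this]
      simp

end Syzygies

/-! ### Functions of several points and nonvanishing of products. -/

section SeparatelyRegular

variable {k P : Type*} [Field k]

/-- Functions of several variables in `P` which lie in `R` as functions of each variable. -/
def separatelyRegular (R : Subalgebra k (P → k)) (ι : Type*) [DecidableEq ι] :
    Subalgebra k ((ι → P) → k) where
  carrier := {F | ∀ q i, (fun z => F (Function.update q i z)) ∈ R}
  mul_mem' hF hG q i := R.mul_mem (hF q i) (hG q i)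
  add_mem' hF hG q i := R.add_mem (hF q i) (hG q i)
  algebraMap_mem' c _ _ := R.algebraMap_mem c

theorem comp_eval_mem_separatelyRegular {R : Subalgebra k (P → k)} {ι : Type*} [DecidableEq ι]
    {f : P → k} (hf : f ∈ R) (a : ι) : (fun q => f (q a)) ∈ separatelyRegular R ι := by
  intro q i
  by_cases h : a = i
  · subst h; simpa using hf
  · simp only [Function.update_of_ne h]
    exact R.algebraMap_mem (f (q a))

/-- A substitute for irreducibility of a product. Starting from nonvanishing points of F and of G,
the coordinates are made equal one at a time: in a single variable both restrictions are nonzero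
elements of the domain R, so some value z serves both. -/
theorem exists_ne_zero_of_mem_separatelyRegular {R : Subalgebra k (P → k)}
    (hR : ∀ f ∈ R, ∀ g ∈ R, f * g = 0 → f = 0 ∨ g = 0) {ι : Type*} [DecidableEq ι] [Fintype ι]
    {F G : (ι → P) → k} (hF : F ∈ separatelyRegular R ι) (hG : G ∈ separatelyRegular R ι)
    (hF0 : F ≠ 0) (hG0 : G ≠ 0) : ∃ q, F q ≠ 0 ∧ G q ≠ 0 := by
  have H : ∀ S : Finset ι, ∃ q q', F q ≠ 0 ∧ G q' ≠ 0 ∧ ∀ i ∈ S, q i = q' i := by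
    intro S
    induction S using Finset.induction_on with
    | empty =>
      obtain ⟨q, hq⟩ := Function.ne_iff.mp hF0
      obtain ⟨q', hq'⟩ := Function.ne_iff.mp hG0
      exact ⟨q, q', hq, hq', by simp⟩
    | insert i S hi ih =>
      obtain ⟨q, q', h1, h2, h3⟩ := ih
      have h4 := mt (hR _ (hF q i) _ (hG q' i)) (by
        rw [not_or]
        exact ⟨fun h => h1 (by simpa using congrFun h (q i)),
          fun h => h2 (by simpa using congrFun h (q' i))⟩)
      obtain ⟨z, hz⟩ := Function.ne_iff.mp h4
      refine ⟨Function.update q i z, Function.update q' i z, left_ne_zero_of_mul hz,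
        right_ne_zero_of_mul hz, fun j hj => ?_⟩
      by_cases hji : j = i
      · subst hji; simp
      · simpa [hji] using h3 j (Finset.mem_of_mem_insert_of_ne hj hji)
  obtain ⟨q, q', h1, h2, h3⟩ := H Finset.univ
  obtain rfl : q = q' := funext fun i => h3 i (Finset.mem_univ i)
  exact ⟨q, h1, h2⟩

/-- The vectors (f_j(z))_j span kⁿ, since a functional killing all of them is a linear relation
among the f_j; n of them form a basis. -/
theorem exists_det_ne_zero {n : ℕ} {f : Fin n → P → k} (hf : LinearIndependent k f) :
    ∃ q : Fin n → P, (Matrix.of fun b a => f b (q a)).det ≠ 0 := by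
  have hspan : Submodule.span k (Set.range fun z : P => fun j => f j z) = ⊤ := by
    by_contra h
    obtain ⟨ψ, hψ, hle⟩ := Submodule.exists_le_ker_of_lt_top _ (lt_top_iff_ne_top.mpr h)
    apply hψ
    refine LinearMap.pi_ext' fun j => LinearMap.ext_ring ?_
    have hz : ∀ z, ∑ j, ψ (Pi.single j 1) * f j z = 0 := fun z => by
      have := hle (Submodule.subset_span ⟨z, rfl⟩)
      rw [LinearMap.mem_ker, LinearMap.pi_apply_eq_sum_univ] at this
      rw [← this]
      refine Finset.sum_congr rfl fun j _ => ?_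
      rw [smul_eq_mul, mul_comm]
      congr 2
      ext x
      simp [Pi.single_apply, eq_comm]
    exact Fintype.linearIndependent_iff.mp hf (fun j => ψ (Pi.single j 1))
      (funext fun z => by simpa using hz z) j
  obtain ⟨g, hg, hgs, hli⟩ := Submodule.exists_fun_fin_finrank_span_eq k
    (Set.range fun z : P => fun j => f j z)
  have hn : Module.finrank k (Submodule.span k (Set.range fun z : P => fun j => f j z)) = n := by
    rw [hspan, finrank_top, Module.finrank_fin_fun]
  choose q hq using hg
  refine ⟨fun a => q (Fin.cast hn.symm a), ?_⟩
  have h2 : LinearIndependent k fun a : Fin n => g (Fin.cast hn.symm a) :=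
    hli.comp _ (Fin.cast_injective _)
  have h3 := Matrix.linearIndependent_rows_iff_isUnit
    (A := Matrix.of fun a : Fin n => g (Fin.cast hn.symm a)) |>.mp h2
  rw [Matrix.isUnit_iff_isUnit_det, ← Matrix.det_transpose] at h3
  convert h3.ne_zero using 2
  ext b a
  simp [← hq]

/-- An identity linear in (s(z), t(z)) for all z holds coefficientwise, by independence of s and t.
So each factor s + l t may be replaced by l − m, that is, (s, t) by the arbitrary pair (−m, 1). -/
theorem sum_mul_prod_sub_eq_zero {s t : P → k} (hst : LinearIndependent k ![s, t])
    {ι : Type*} [Fintype ι] (l : ι → k) {n : ℕ} : ∀ (c : ι → k)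
    (_ : ∀ q : Fin n → P, ∑ j, c j * ∏ a, (s (q a) + l j * t (q a)) = 0) (m : Fin n → k),
    ∑ j, c j * ∏ a, (l j - m a) = 0 := by
  induction n with
  | zero => intro c h m; simpa using h Fin.elim0
  | succ n ih =>
    intro c h m
    have h1 : ∀ z : P, ∑ j, (c j * (s z + l j * t z)) * ∏ a, (l j - Fin.tail m a) = 0 := by
      intro z
      refine ih _ (fun q => ?_) (Fin.tail m)
      rw [← h (Fin.cons z q)]
      refine Finset.sum_congr rfl fun j _ => ?_
      simp [Fin.prod_univ_succ, mul_assoc]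
    obtain ⟨hA, hB⟩ := LinearIndependent.pair_iff.mp hst
      (∑ j, c j * ∏ a, (l j - Fin.tail m a)) (∑ j, c j * l j * ∏ a, (l j - Fin.tail m a)) (by
        ext z
        refine Eq.trans ?_ (h1 z)
        simp only [Pi.add_apply, Pi.smul_apply, smul_eq_mul, Finset.sum_mul,
          ← Finset.sum_add_distrib]
        refine Finset.sum_congr rfl fun j _ => ?_
        ring)
    calc ∑ j, c j * ∏ a, (l j - m a)
        = ∑ j, c j * l j * ∏ a, (l j - Fin.tail m a)
          - m 0 * ∑ j, c j * ∏ a, (l j - Fin.tail m a) := by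
          rw [Finset.mul_sum, ← Finset.sum_sub_distrib]
          refine Finset.sum_congr rfl fun j _ => ?_
          simp only [Fin.prod_univ_succ, Fin.tail]
          ring
      _ = 0 := by rw [hA, hB]; ring

theorem eq_zero_of_sum_mul_prod_eq_zero {s t : P → k} (hst : LinearIndependent k ![s, t])
    {n : ℕ} {l : Fin (n + 1) → k} (hl : Function.Injective l) {c : Fin (n + 1) → k}
    (h : ∀ q : Fin n → P, ∑ j, c j * ∏ a, (s (q a) + l j * t (q a)) = 0) : c = 0 := by
  funext i
  -- Lagrange interpolation: placing the n roots at the other values of l isolates the term i.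
  have := sum_mul_prod_sub_eq_zero hst l c h fun a => l (i.succAbove a)
  rw [Finset.sum_eq_single i] at this
  · refine (mul_eq_zero.mp this).resolve_right (Finset.prod_ne_zero_iff.mpr fun a _ => ?_)
    exact sub_ne_zero.mpr (hl.ne (Fin.succAbove_ne i a).symm)
  · intro j _ hj
    obtain ⟨a, rfl⟩ := Fin.exists_succAbove_eq hj
    rw [Finset.prod_eq_zero (Finset.mem_univ a) (sub_self _), mul_zero]
  · simp

end SeparatelyRegular

/-! ### Independence of the determinantal classes. -/

section Independence

variable {k P V : Type*} [Field k] [AddCommGroup V] [Module k V]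

/-- Each column of the evaluated matrix is the column of values of β at one point, scaled by t at
the first point and by s + l t at the others. -/
theorem evalMinors_minorSyzygy_of_pencil {p : ℕ} (ev : P → V →ₗ[k] k) {s t : P → k}
    {β : Fin (p + 1) → P → k} {x y : Fin (p + 1) → V} (hx : ∀ z j, ev z (x j) = s z * β j z)
    (hy : ∀ z j, ev z (y j) = t z * β j z) (l : k) (q : Fin (p + 1) → P) :
    evalMinors (fun a => ev (q a)) (minorSyzygy y (x + l • y)) =
      t (q 0) * (∏ a : Fin p, (s (q a.succ) + l * t (q a.succ))) *
        (Matrix.of fun b a => β b (q a)).det := by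
  rw [evalMinors_minorSyzygy]
  have := Matrix.det_mul_row (Fin.cons (t (q 0)) fun a : Fin p => s (q a.succ) + l * t (q a.succ) :
    Fin (p + 1) → k) (Matrix.of fun b a => β b (q a))
  rw [Fin.prod_univ_succ] at this
  simp only [Fin.cons_zero, Fin.cons_succ] at this
  rw [← this]
  congr 2
  ext b a
  refine Fin.cases ?_ (fun a => ?_) a
  · simp [hy]
  · simp [hx, hy]
    ring

theorem linearIndependent_minorSyzygy (R : Subalgebra k (P → k))
    (hR : ∀ f ∈ R, ∀ g ∈ R, f * g = 0 → f = 0 ∨ g = 0)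
    {M : Type*} [AddCommGroup M] [Module k M]
    (μ : V →ₗ[k] M →ₗ[k] V) (hμ : ∀ m, ∃ c : k, ∀ v, μ v m = c • v)
    (ev : P → V →ₗ[k] k) {s t : P → k} (hs : s ∈ R) (ht : t ∈ R)
    (hst : LinearIndependent k ![s, t]) {p : ℕ} {β : Fin (p + 2) → P → k} (hβR : ∀ j, β j ∈ R)
    (hβ : LinearIndependent k β) {x y : Fin (p + 2) → V}
    (hx : ∀ z j, ev z (x j) = s z * β j z) (hy : ∀ z j, ev z (y j) = t z * β j z)
    {l : Fin (p + 1) → k} (hl : Function.Injective l) {c : Fin (p + 1) → k}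
    (hc : ∑ i, c i • minorSyzygy y (x + l i • y) ∈
      LinearMap.range (koszulDifferential μ (p + 1))) : c = 0 := by
  let A : (Fin (p + 2) → P) → k := fun q => t (q 0) * s (q 1) - t (q 1) * s (q 0)
  let B : (Fin (p + 2) → P) → k := fun q =>
    ∑ i, c i * ∏ a : Fin p, (s (q a.succ.succ) + l i * t (q a.succ.succ))
  let D : (Fin (p + 2) → P) → k := fun q => (Matrix.of fun b a => β b (q a)).det
  -- Exchanging the first two points negates D; in the sum of the two evaluations the terms l · t(q
  -- 0) · t(q 1) cancel, leaving A, which does not depend on l.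
  have key : ∀ q, A q * B q * D q = 0 := by
    intro q
    have h1 := evalMinors_add_evalMinors_swap_eq_zero μ hμ (fun a => ev (q a))
      (zero_ne_one : (0 : Fin (p + 2)) ≠ 1) hc
    have h2 : (fun a => ev (q a)) ∘ Equiv.swap (0 : Fin (p + 2)) 1 =
      fun a => ev ((q ∘ Equiv.swap 0 1) a) := rfl
    rw [h2] at h1
    simp only [map_sum, map_smul, evalMinors_minorSyzygy_of_pencil ev hx hy] at h1
    have hdet : (Matrix.of fun b a => β b ((q ∘ Equiv.swap (0 : Fin (p + 2)) 1) a)).det =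
        - D q := by
      have := Matrix.det_permute' (Equiv.swap (0 : Fin (p + 2)) 1) (Matrix.of fun b a => β b (q a))
      rw [Equiv.Perm.sign_swap zero_ne_one] at this
      refine Eq.trans ?_ (this.trans ?_)
      · rfl
      · simp [D]
    rw [hdet, ← Finset.sum_add_distrib] at h1
    refine Eq.trans ?_ h1
    simp only [B, Finset.mul_sum, Finset.sum_mul]
    refine Finset.sum_congr rfl fun i _ => ?_
    have hsw : ∀ a : Fin p, Equiv.swap (0 : Fin (p + 2)) 1 a.succ.succ = a.succ.succ := fun a =>
      Equiv.swap_apply_of_ne_of_ne (Fin.succ_ne_zero _) (by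
        rw [← Fin.succ_zero_eq_one]
        exact (Fin.succ_injective _).ne (Fin.succ_ne_zero a))
    simp only [Fin.prod_univ_succ, Function.comp_apply, Equiv.swap_apply_left, Fin.succ_zero_eq_one,
      Equiv.swap_apply_right, hsw, A, smul_eq_mul]
    change _ = c i * (_ * D q) + _
    ring
  have hev : ∀ {f}, f ∈ R → ∀ a : Fin (p + 2),
      (fun q : Fin (p + 2) → P => f (q a)) ∈ separatelyRegular R (Fin (p + 2)) :=
    fun hf a => comp_eval_mem_separatelyRegular hf a
  have hAR : A ∈ separatelyRegular R (Fin (p + 2)) :=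
    Subalgebra.sub_mem _ (Subalgebra.mul_mem _ (hev ht 0) (hev hs 1))
      (Subalgebra.mul_mem _ (hev ht 1) (hev hs 0))
  have hBR : B ∈ separatelyRegular R (Fin (p + 2)) := by
    have : B = ∑ i, c i • ∏ a : Fin p, ((fun q : Fin (p + 2) → P => s (q a.succ.succ)) +
        l i • fun q : Fin (p + 2) → P => t (q a.succ.succ)) := by
      ext q
      simp [B]
    rw [this]
    exact Subalgebra.sum_mem _ fun i _ => Subalgebra.smul_mem _ (Subalgebra.prod_mem _ fun a _ =>
      Subalgebra.add_mem _ (hev hs _) (Subalgebra.smul_mem _ (hev ht _) _)) _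
  have hDR : D ∈ separatelyRegular R (Fin (p + 2)) := by
    have : D = ∑ σ : Equiv.Perm (Fin (p + 2)), Equiv.Perm.sign σ •
        ∏ a, fun q : Fin (p + 2) → P => β (σ a) (q a) := by
      ext q
      simp [D, Matrix.det_apply]
    rw [this]
    refine Subalgebra.sum_mem _ fun σ _ => ?_
    rw [Units.smul_def]
    exact Subalgebra.zsmul_mem _ (Subalgebra.prod_mem _ fun a _ => hev (hβR _) _) _
  obtain ⟨q₀, hq₀⟩ := exists_det_ne_zero hβ
  have hD0 : D ≠ 0 := fun h => hq₀ (congrFun h q₀)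
  by_contra hc0
  have hB : ∃ q : Fin p → P, ∑ i, c i * ∏ a, (s (q a) + l i * t (q a)) ≠ 0 := by
    by_contra! h
    exact hc0 (eq_zero_of_sum_mul_prod_eq_zero hst hl h)
  obtain ⟨q₂, hq₂⟩ := hB
  obtain ⟨q₁, hq₁⟩ := exists_det_ne_zero hst
  -- A uses only the first two points and B only the others, so their nonvanishing points combine
  -- freely. D involves all the points and needs the domain argument.
  have hAB : A * B ≠ 0 := fun h => by
    have := congrFun h (Fin.cons (q₁ 0) (Fin.cons (q₁ 1) q₂))
    simp only [A, B, Pi.mul_apply, Pi.zero_apply, mul_eq_zero, Fin.cons_zero, Fin.cons_succ] at this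
    refine this.elim (fun h => hq₁ ?_) hq₂
    rw [Matrix.det_fin_two]
    simp only [Matrix.of_apply, Matrix.cons_val_zero, Matrix.cons_val_one]
    change t (q₁ 0) * s (q₁ 1) - t (q₁ 1) * s (q₁ 0) = 0 at h
    linear_combination -h
  obtain ⟨q, h1, h2⟩ := exists_ne_zero_of_mem_separatelyRegular hR
    (Subalgebra.mul_mem _ hAR hBR) hDR hAB hD0
  exact mul_ne_zero h1 h2 (key q)

/-- If `x j = s b j` and `y j = t b j` for a pencil `s, t`, then the middle Koszul cohomology has
dimension at least `p + 1`. -/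
theorem le_finrank_koszulCohomology [Infinite k] [Module.Finite k V] (R : Subalgebra k (P → k))
    (hR : ∀ f ∈ R, ∀ g ∈ R, f * g = 0 → f = 0 ∨ g = 0)
    {M N : Type*} [AddCommGroup M] [Module k M] [AddCommGroup N] [Module k N]
    (μ₀ : V →ₗ[k] M →ₗ[k] V) (hμ₀ : ∀ m, ∃ c : k, ∀ v, μ₀ v m = c • v) (μ₁ : V →ₗ[k] V →ₗ[k] N)
    (ev : P → V →ₗ[k] k) {s t : P → k} (hs : s ∈ R) (ht : t ∈ R)
    (hst : LinearIndependent k ![s, t]) {p : ℕ} {β : Fin (p + 2) → P → k} (hβR : ∀ j, β j ∈ R)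
    (hβ : LinearIndependent k β) {x y : Fin (p + 2) → V}
    (hx : ∀ z j, ev z (x j) = s z * β j z) (hy : ∀ z j, ev z (y j) = t z * β j z)
    (hxy : ∀ i j, μ₁ (x i) (y j) = μ₁ (x j) (y i)) (hyy : ∀ i j, μ₁ (y i) (y j) = μ₁ (y j) (y i)) :
    p + 1 ≤ Module.finrank k (KoszulCohomology μ₀ μ₁ (p + 1)) := by
  let l : Fin (p + 1) → k := fun i => Infinite.natEmbedding k i
  have hl : Function.Injective l := (Infinite.natEmbedding k).injective.comp Fin.val_injective
  have hcyc : ∀ i, minorSyzygy y (x + l i • y) ∈ koszulCycles μ₁ (p + 1) := fun i =>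
    koszulDifferential_minorSyzygy μ₁ _ _ fun a b => by
      simp only [Pi.add_apply, Pi.smul_apply, map_add, map_smul, LinearMap.add_apply,
        LinearMap.smul_apply, hxy a b, hyy a b]
  have hind : LinearIndependent k fun i =>
      (Submodule.Quotient.mk ⟨_, hcyc i⟩ : KoszulCohomology μ₀ μ₁ (p + 1)) := by
    rw [Fintype.linearIndependent_iff]
    intro c hc
    refine congrFun (linearIndependent_minorSyzygy R hR μ₀ hμ₀ ev hs ht hst hβR hβ hx hy hl ?_)
    have hmk : Submodule.mkQ ((LinearMap.range (koszulDifferential μ₀ (p + 1))).submoduleOf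
        (koszulCycles μ₁ (p + 1))) (∑ i, c i • ⟨_, hcyc i⟩) = 0 := by
      rw [map_sum]
      exact hc
    rw [Submodule.mkQ_apply, Submodule.Quotient.mk_eq_zero, Submodule.submoduleOf,
      Submodule.mem_comap, map_sum] at hmk
    exact hmk
  simpa using hind.fintype_card_le_finrank

end Independence

/-! ### From pointwise functions to a function field. -/

section Pencil

variable {k : Type*} [Field k] [IsAlgClosed k]

/-- The Nullstellensatz for A[1/f]: its residue field at a maximal ideal is k, and f becomes a unit.
-/
theorem exists_algHom_ne_zero (A : Type*) [CommRing A] [IsDomain A] [Algebra k A]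
    [Algebra.FiniteType k A] {f : A} (hf : f ≠ 0) : ∃ φ : A →ₐ[k] k, φ f ≠ 0 := by
  let B := Localization.Away f
  have hB : Nontrivial B := (IsLocalization.injective B
    (powers_le_nonZeroDivisors_of_noZeroDivisors hf)).nontrivial
  obtain ⟨m, hm⟩ := Ideal.exists_maximal B
  have : Algebra.FiniteType A B := IsLocalization.finiteType_of_monoid_fg (.powers f) B
  have : Algebra.FiniteType k B := Algebra.FiniteType.trans (S := A) inferInstance inferInstance
  let := Ideal.Quotient.field m
  have : Module.Finite k (B ⧸ m) := finite_of_finite_type_of_isJacobsonRing k (B ⧸ m)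
  let e := AlgEquiv.ofBijective (Algebra.ofId k (B ⧸ m))
    (IsAlgClosed.algebraMap_bijective_of_isIntegral (k := k) (K := B ⧸ m))
  let φ : A →ₐ[k] k :=
    e.symm.toAlgHom.comp ((Ideal.Quotient.mkₐ k m).comp (IsScalarTower.toAlgHom k A B))
  refine ⟨φ, ?_⟩
  exact ((IsLocalization.Away.algebraMap_isUnit (S := B) f).map
    (e.symm.toAlgHom.comp (Ideal.Quotient.mkₐ k m))).ne_zero

theorem le_finrank_koszulCohomology_of_pencil {K V M N : Type*} [Field K] [Algebra k K]
    [AddCommGroup V] [Module k V] [Module.Finite k V]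
    [AddCommGroup M] [Module k M] [AddCommGroup N] [Module k N]
    (μ₀ : V →ₗ[k] M →ₗ[k] V) (hμ₀ : ∀ m, ∃ c : k, ∀ v, μ₀ v m = c • v) (μ₁ : V →ₗ[k] V →ₗ[k] N)
    (φ : V →ₗ[k] K) (hμ₁ : ∀ v w v' w', φ v * φ w = φ v' * φ w' → μ₁ v w = μ₁ v' w')
    {p : ℕ} {s t : K} (hst : LinearIndependent k ![s, t]) {b : Fin (p + 2) → K}
    (hb : LinearIndependent k b) (hsb : ∀ j, s * b j ∈ LinearMap.range φ)
    (htb : ∀ j, t * b j ∈ LinearMap.range φ) :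
    p + 1 ≤ Module.finrank k (KoszulCohomology μ₀ μ₁ (p + 1)) := by
  choose x hx using hsb
  choose y hy using htb
  obtain ⟨G, hG⟩ := (Module.Finite.fg_top : (⊤ : Submodule k V).FG)
  -- Evaluation points are the k-algebra homomorphisms to k from a finitely generated subalgebra of
  -- K containing all functions involved. They separate its elements, so it embeds in the functions
  -- on these points and its image has no zero divisors.
  let S : Set K := {s, t} ∪ Set.range b ∪ φ '' G
  have hS : S.Finite := ((Set.toFinite _).union (Set.finite_range b)).union (G.finite_toSet.image φ)
  let A := Algebra.adjoin k S
  have : Algebra.FiniteType k A := Subalgebra.fg_iff_finiteType _ |>.mp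
    (Subalgebra.fg_def.mpr ⟨S, hS, rfl⟩)
  have hφ : ∀ v, φ v ∈ A := by
    have : (⊤ : Submodule k V) ≤ (Subalgebra.toSubmodule A).comap φ := by
      rw [← hG, Submodule.span_le]
      exact fun g hg => Algebra.subset_adjoin (Or.inr ⟨g, hg, rfl⟩)
    exact fun v => this (x := v) trivial
  let φA : V →ₗ[k] A := φ.codRestrict (Subalgebra.toSubmodule A) hφ
  let Ev : A →ₐ[k] ((A →ₐ[k] k) → k) := AlgHom.pi fun z : A →ₐ[k] k => z
  have hEv : Function.Injective Ev := by
    rw [injective_iff_map_eq_zero]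
    intro f hf
    by_contra h
    obtain ⟨z, hz⟩ := exists_algHom_ne_zero (k := k) A h
    exact hz (congrFun hf z)
  let sA : A := ⟨s, Algebra.subset_adjoin (Or.inl (Or.inl (Or.inl rfl)))⟩
  let tA : A := ⟨t, Algebra.subset_adjoin (Or.inl (Or.inl (Or.inr rfl)))⟩
  let bA : Fin (p + 2) → A := fun j => ⟨b j, Algebra.subset_adjoin (Or.inl (Or.inr ⟨j, rfl⟩))⟩
  have hxA : ∀ j, φA (x j) = sA * bA j := fun j => Subtype.ext (hx j)
  have hyA : ∀ j, φA (y j) = tA * bA j := fun j => Subtype.ext (hy j)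
  have hst' : LinearIndependent k ![Ev sA, Ev tA] := by
    have h1 : LinearIndependent k ![sA, tA] := LinearIndependent.of_comp A.val.toLinearMap (by
      convert hst
      ext i
      fin_cases i <;> rfl)
    have h2 : ![Ev sA, Ev tA] = Ev.toLinearMap ∘ ![sA, tA] := by
      ext i
      fin_cases i <;> rfl
    rw [h2]
    exact h1.map' Ev.toLinearMap (LinearMap.ker_eq_bot.mpr hEv)
  have hb' : LinearIndependent k fun j => Ev (bA j) :=
    (LinearIndependent.of_comp (v := bA) A.val.toLinearMap hb).map' Ev.toLinearMap
      (LinearMap.ker_eq_bot.mpr hEv)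
  have : Infinite k := IsAlgClosed.instInfinite
  refine le_finrank_koszulCohomology Ev.range ?_ μ₀ hμ₀ μ₁
    (fun z => z.toLinearMap ∘ₗ φA) (s := Ev sA) (t := Ev tA) ⟨_, rfl⟩ ⟨_, rfl⟩ hst'
    (β := fun j => Ev (bA j)) (fun j => ⟨_, rfl⟩) hb' (x := x) (y := y) ?_ ?_ ?_ ?_
  · rintro _ ⟨f, rfl⟩ _ ⟨g, rfl⟩ h
    change Ev f * Ev g = 0 at h
    rw [← map_mul, map_eq_zero_iff _ hEv, mul_eq_zero] at h
    exact h.imp (fun h => by rw [h]; exact map_zero _) (fun h => by rw [h]; exact map_zero _)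
  · intro z j
    change z (φA (x j)) = z sA * z (bA j)
    rw [hxA, map_mul]
  · intro z j
    change z (φA (y j)) = z tA * z (bA j)
    rw [hyA, map_mul]
  · exact fun i j => hμ₁ _ _ _ _ (by rw [hx, hy, hx, hy]; ring)
  · exact fun i j => hμ₁ _ _ _ _ (mul_comm _ _)

end Pencil

/-! ### Products of sections of a line bundle. -/

namespace SmoothCurve

variable {C : SmoothCurve}

theorem IsLineBundle.exists_generator {L : C.X.Modules} (hL : C.IsLineBundle L) (x : C.X) :
    ∃ U : C.X.Opens, x ∈ U ∧ ∃ e : Γ(L, U), ∀ s : Γ(L, U), ∃ f : Γ(C.X, U), s = f • e := by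
  obtain ⟨U, hx, ⟨i⟩⟩ := hL x
  have hxU : x ∈ U.ι ''ᵁ ⊤ := by simpa using hx
  let ψ : Γ(U, ⊤) → Γ(L, U.ι ''ᵁ ⊤) := fun r => i.inv.app ⊤ r
  refine ⟨U.ι ''ᵁ ⊤, hxU, ψ 1, fun s => ?_⟩
  let r : Γ(U, ⊤) := i.hom.app ⊤ s
  refine ⟨(U.ι.appIso ⊤).inv r, ?_⟩
  have h1 : ψ r = s := by
    have := congr($(i.hom_inv_id).app ⊤ s)
    exact this
  have h2 : ψ (r * 1) = (U.ι.appIso ⊤).inv r • ψ 1 :=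
    Scheme.Modules.Hom.app_smul i.inv r (1 : Γ(U, ⊤))
  rw [← h2, mul_one, h1]

/-- The canonical map `L(U) ⊗ M(U) → (L ⊗ M)(U)`. -/
def tensorLocalSections (L M : C.X.Modules) (U : C.X.Opens)
    (z : Γ(L, U) ⊗[Γ(C.X, U)] Γ(M, U)) : Γ(tensor L M, U) :=
  ((PresheafOfModules.sheafificationAdjunction (𝟙 C.X.ringCatSheaf.obj)).unit.app
    (presheafTensor L M)).app (.op U) (show (presheafTensor L M).obj (.op U) from z)

theorem map_tensorLocalSections_tmul (L M : C.X.Modules) {U V : C.X.Opens} (i : U ⟶ V)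
    (s : Γ(L, V)) (t : Γ(M, V)) :
    (tensor L M).presheaf.map i.op (tensorLocalSections L M V (s ⊗ₜ t)) =
      tensorLocalSections L M U (L.presheaf.map i.op s ⊗ₜ M.presheaf.map i.op t) :=
  (PresheafOfModules.naturality_apply ((PresheafOfModules.sheafificationAdjunction
    (𝟙 C.X.ringCatSheaf.obj)).unit.app (presheafTensor L M)) i.op _).symm

/-- Products of sections of a line bundle are determined by the products of the corresponding
rational functions. -/
theorem mulSections_eq_mulSections {L : C.X.Modules} (hL : C.IsLineBundle L)
    (φ : ∀ (U : C.X.Opens) [Nonempty U], Γ(L, U) →ₗ[Γ(C.X, U)] C.X.functionField)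
    (hφ : ∀ (U V : C.X.Opens) [Nonempty U] [Nonempty V] (i : U ⟶ V) (s : Γ(L, V)),
      φ U (L.presheaf.map i.op s) = φ V s)
    (hinj : ∀ (U : C.X.Opens) [Nonempty U], Function.Injective (φ U))
    {s t s' t' : Γ(L, (⊤ : C.X.Opens))} (h : φ ⊤ s * φ ⊤ t = φ ⊤ s' * φ ⊤ t') :
    mulSections L L s t = mulSections L L s' t' := by
  change tensorLocalSections L L ⊤ (s ⊗ₜ t) = tensorLocalSections L L ⊤ (s' ⊗ₜ t')
  -- Equality in a sheaf is local. Where e generates L, both tensors are multiples of e ⊗ e, and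
  -- their coefficients are compared in the function field after cancelling φ(e)².
  choose U hxU e he using fun x => hL.exists_generator x
  refine TopCat.Sheaf.eq_of_locally_eq' ⟨(tensor L L).presheaf, (tensor L L).isSheaf⟩ U ⊤
    (fun x => homOfLE le_top) (fun x _ => TopologicalSpace.Opens.mem_iSup.mpr ⟨x, hxU x⟩) _ _ ?_
  intro x
  change (tensor L L).presheaf.map _ _ = (tensor L L).presheaf.map _ _
  rw [map_tensorLocalSections_tmul, map_tensorLocalSections_tmul]
  have : Nonempty (U x) := ⟨⟨x, hxU x⟩⟩
  have hr := fun w : Γ(L, (⊤ : C.X.Opens)) => hφ (U x) ⊤ (homOfLE le_top) w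
  obtain ⟨f, hf⟩ := he x (L.presheaf.map (homOfLE le_top).op s)
  obtain ⟨g, hg⟩ := he x (L.presheaf.map (homOfLE le_top).op t)
  obtain ⟨f', hf'⟩ := he x (L.presheaf.map (homOfLE le_top).op s')
  obtain ⟨g', hg'⟩ := he x (L.presheaf.map (homOfLE le_top).op t')
  rw [← hr s, ← hr t, ← hr s', ← hr t', hf, hg, hf', hg', map_smul, map_smul, map_smul, map_smul]
    at h
  rw [hf, hg, hf', hg', TensorProduct.smul_tmul_smul, TensorProduct.smul_tmul_smul]
  by_cases h0 : e x = 0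
  · simp [h0]
  congr 2
  have h1 : φ (U x) (e x) ≠ 0 := (map_ne_zero_iff _ (hinj (U x))).mpr h0
  have h2 : (f * g) • (φ (U x) (e x) * φ (U x) (e x)) =
      (f' * g') • (φ (U x) (e x) * φ (U x) (e x)) := by
    rwa [smul_mul_smul_comm, smul_mul_smul_comm] at h
  rw [Algebra.smul_def, Algebra.smul_def] at h2
  exact C.X.germToFunctionField_injective _ (mul_right_cancel₀ (mul_ne_zero h1 h1) h2)

end SmoothCurve

/-! ### Global sections as rational functions, and pencils. -/

namespace SmoothCurve

variable {C : SmoothCurve}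

/-- Global sections as rational functions, `ℂ`-linearly. -/
def sectionsToFunctionField {L : C.X.Modules}
    (φ : Γ(L, (⊤ : C.X.Opens)) →ₗ[Γ(C.X, ⊤)] C.X.functionField) : H0 L →ₗ[ℂ] C.K where
  toFun s := φ s
  map_add' := map_add φ
  map_smul' c s := (φ.map_smul (show Γ(C.X, ⊤) from C.scalars c) s).trans (Algebra.smul_def _ _)

theorem range_sectionsToFunctionField {L : C.X.Modules} {D : C.Divisor}
    {φ : Γ(L, (⊤ : C.X.Opens)) →ₗ[Γ(C.X, ⊤)] C.X.functionField}
    (h : Set.range φ = {f | f ≠ 0 → ∀ x : C.Point, x.1 ∈ (⊤ : C.X.Opens) →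
      0 ≤ Scheme.ord f x.1 + D x}) :
    LinearMap.range (sectionsToFunctionField φ) = C.riemannRochSpace D := by
  ext f
  have h1 : f ∈ LinearMap.range (sectionsToFunctionField φ) ↔ f ∈ Set.range φ := Iff.rfl
  rw [h1, h, mem_riemannRochSpace]
  exact ⟨fun hf x h0 => hf h0 x trivial, fun hf h0 x _ => hf x h0⟩

theorem mul_mem_riemannRochSpace {D E : C.Divisor} {f g : C.K} (hf : f ∈ C.riemannRochSpace D)
    (hg : g ∈ C.riemannRochSpace E) : f * g ∈ C.riemannRochSpace (D + E) := by
  rw [mem_riemannRochSpace] at *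
  intro x h0
  obtain ⟨h1, h2⟩ := mul_ne_zero_iff.mp h0
  have := hf x h1
  have := hg x h2
  rw [C.ordAt_mul x h1 h2, Finsupp.add_apply]
  omega

/-- A curve of gonality at most `n` carries a divisor of degree at most `n` with two independent
functions in its Riemann-Roch space. -/
theorem exists_pencil {n : ℕ} (h : C.gonality ≤ n) : ∃ D : C.Divisor, C.divisorDegree D ≤ n ∧
    ∃ f : Fin 2 → C.K, LinearIndependent ℂ f ∧ ∀ j, f j ∈ C.riemannRochSpace D := by
  -- A strict bound on the infimum produces an actual line bundle of degree below n + 1.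
  have h1 : C.gonality < (n + 1 : ℕ) := lt_of_le_of_lt h (by exact_mod_cast n.lt_succ_self)
  obtain ⟨_, ⟨d, A, -, ⟨D, ⟨φ, -, hφ⟩, hD⟩, hA, rfl⟩, hd⟩ := sInf_lt_iff.mp h1
  obtain ⟨f, hf⟩ := exists_linearIndependent_of_le_finrank hA
  obtain ⟨hinj, hrange⟩ := hφ ⊤
  refine ⟨D, ?_, sectionsToFunctionField (φ ⊤) ∘ f,
    hf.map' _ (LinearMap.ker_eq_bot.mpr hinj), fun j => ?_⟩
  · rw [hD]
    have : d < n + 1 := by exact_mod_cast hd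
    omega
  · rw [← range_sectionsToFunctionField hrange]
    exact ⟨f j, rfl⟩

end SmoothCurve

end

theorem proposition2p4 (i : ℕ) (C : SmoothCurve) (hg : C.genus = 2 * i + 1)
    (hgon : C.gonality ≤ (i + 1 : ℕ)) (L : C.X.Modules) (hL : C.IsLineBundle L)
    (hdeg : C.HasDegree L (2 * C.genus : ℕ)) :
    i ≤ Module.finrank ℂ (SmoothCurve.KoszulOne i L) := by
  obtain _ | p := i
  · exact Nat.zero_le _
  -- `finrank` is 0 on infinite-dimensional spaces, so positive genus already forces H¹ to be
  -- finite-dimensional.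
  have hH1 : Module.Finite ℂ C.H1 := Module.finite_of_finrank_pos (by
    change 0 < C.genus
    omega)
  obtain ⟨E, hE, f, hf, hfE⟩ := SmoothCurve.exists_pencil hgon
  obtain ⟨D, ⟨φ, hres, hφ⟩, hD⟩ := hdeg
  obtain ⟨hinj, hrange⟩ := hφ ⊤
  have hr := SmoothCurve.range_sectionsToFunctionField hrange
  -- With i = p + 1: deg(D − E) + 1 − g ≥ (4i + 2) − (i + 1) + 1 − (2i + 1) = i + 1.
  have hdim : p + 2 ≤ Module.finrank ℂ (C.riemannRochSpace (D - E)) := by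
    have h1 := C.divisorDegree_add_one_le (D - E)
    have h2 := C.divisorDegree_add (D - E) E
    rw [sub_add_cancel] at h2
    rw [hg] at h1 hD
    push_cast at h1 hD hE
    omega
  obtain ⟨b, hb⟩ := exists_linearIndependent_of_le_finrank hdim
  have hfin : Module.Finite ℂ (SmoothCurve.H0 L) :=
    Module.Finite.of_injective ((SmoothCurve.sectionsToFunctionField (φ ⊤)).codRestrict
      (C.riemannRochSpace D) fun s => hr ▸ ⟨s, rfl⟩)
      fun s t h => hinj (congrArg Subtype.val h)
  have hmem : ∀ j k, f j * (b k : C.K) ∈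
      LinearMap.range (SmoothCurve.sectionsToFunctionField (φ ⊤)) := fun j k => by
    have := SmoothCurve.mul_mem_riemannRochSpace (hfE j) (b k).2
    rwa [add_sub_cancel, ← hr] at this
  have hst : LinearIndependent ℂ ![f 0, f 1] := by
    convert hf
    ext j
    fin_cases j <;> rfl
  refine le_finrank_koszulCohomology_of_pencil _ ?_ _
    (SmoothCurve.sectionsToFunctionField (φ ⊤)) ?_ hst
    (hb.map' (C.riemannRochSpace (D - E)).subtype (Submodule.ker_subtype _))
    (fun j => hmem 0 j) fun j => hmem 1 j
  -- Global functions are constants, so they act on sections by scalars.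
  · intro m
    obtain ⟨c, rfl⟩ := C.scalars_surjective m
    exact ⟨c, fun v => rfl⟩
  · exact fun v w v' w' h => SmoothCurve.mulSections_eq_mulSections hL φ hres
      (fun U _ => (hφ U).1) h
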